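/- Let $d\ge 3$ and $\beta\ge 2$ be integers and let $M\subset\mathbb R^D$ be a compact $d$-dimensional embedded $C^\beta$ submanifold (without boundary). For $y\in M$ let $T_yM\subset\mathbb R^D$ be the tangent space, regarded as a linear subspace, and let $\mathrm{pr}_{T_yM}$ be the orthogonal projection onto it. Let $$\tau:=\sup\{\varepsilon : \text{every } x\in\mathbb R^D \text{ with } \mathrm{dist}(x,M)<\varepsilon \text{ has exactly one nearest point in } M\}$$ be the reach of $M$, and suppose that $\tau>\tau_{\min}$ for a constant $\tau_{\min}>0$. Let $\Phi_y$ be the inverse of the map $x\mapsto \mathrm{pr}_{T_yM}(x-y)$ restricted to $M\cap B(y,\tau/4)$, and suppose that there is a constant $L_M>0$ such that for all $y\in M$ $$\|\Phi_y\|_{C^\beta(B_{T_yM}(0,\tau/8))}:=\max_{0\le i\le \beta}\ \sup_{z\in B_{T_yM}(0,\tau/8)}\|d^i\Phi_y(z)\|_{op}\le L_M .$$ Put $r_0:=\min(1,\tau,L_M^{-1})/8$, let $\mathrm{Vol}\,M$ be the $d$-dimensional volume (Hausdorff measure, normalized to agree with Lebesgue measure on $\mathbb R^d$) of $M$, and write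 $\log_+x=\max(\log x,0)$. Let $Z_D\sim\mathcal N(0,\mathrm{Id}_D)$ be a standard Gaussian vector in $\mathbb R^D$. Then for any $\delta>0$, with probability at least $1-\delta$, for all $y\in M$ simultaneously, $$\|\mathrm{pr}_{T_yM}Z_D\|\le 8\sqrt{d\left(4\log(2d)+2\log r_0^{-1}+2\log_+\mathrm{Vol}\,M+2\log\delta^{-1}\right)} .$$ -/

import Mathlib

open Set Metric Topology MeasureTheory ProbabilityTheory
open scoped ENNReal

noncomputable section

namespace ManifoldNoise

variable {E : Type*} [NormedAddCommGroup E] [InnerProductSpace ℝ E]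

/-- The reach of `M`: the supremum of all `ε` such that every point at distance less than `ε` from
`M` has exactly one nearest point in `M`. It takes values in `[0, ∞]`. -/
def reach (M : Set E) : ℝ≥0∞ :=
  sSup {ε : ℝ≥0∞ | ∀ x : E, infEDist x M < ε → ∃! y : E, y ∈ M ∧ edist x y = infEDist x M}

/-- `M` is a `d`-dimensional `C^β` submanifold (without boundary) of `E`: near each of its points
`y` it is the image of a `C^β` immersion `Φ` defined on an open neighbourhood `U` of `0` in `ℝ^d`,
with `Φ 0 = y`, which is one-to-one and a homeomorphism onto a relatively open subset of `M`. -/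
def IsSmoothSubmanifold (d β : ℕ) (M : Set E) : Prop :=
  ∀ y ∈ M, ∃ (U : Set (EuclideanSpace ℝ (Fin d))) (V : Set E) (Φ : EuclideanSpace ℝ (Fin d) → E),
    IsOpen U ∧ 0 ∈ U ∧ IsOpen V ∧ Φ 0 = y ∧
    ContDiffOn ℝ β Φ U ∧ (∀ z ∈ U, Function.Injective (fderiv ℝ Φ z)) ∧
    IsEmbedding (fun z : U => Φ z) ∧ Φ '' U = M ∩ V

/-- The tangent space `T_y M`, as a linear subspace of the ambient space: the velocities at `y` of
curves in `M` passing through `y` at time `0`. (For a submanifold these velocities already form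
a subspace; the span only serves to obtain one for an arbitrary set `M`.) -/
def tangentSpace (M : Set E) (y : E) : Submodule ℝ E :=
  Submodule.span ℝ
    {v : E | ∃ γ : ℝ → E, γ 0 = y ∧ HasDerivAt γ v 0 ∧ ∀ᶠ t in 𝓝 (0 : ℝ), γ t ∈ M}

/-- `‖f‖_{C^k(Ω)} ≤ L`, for the norm `max_{0 ≤ i ≤ k} sup_{z ∈ Ω} ‖d^i f(z)‖_op`; this
includes that `f` is of class `C^k` on `Ω`. -/
def CkNormLE {F G : Type*} [NormedAddCommGroup F] [NormedSpace ℝ F] [NormedAddCommGroup G]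
    [NormedSpace ℝ G] (k : ℕ) (Ω : Set F) (f : F → G) (L : ℝ) : Prop :=
  ContDiffOn ℝ k f Ω ∧ ∀ i ≤ k, ∀ z ∈ Ω, ‖iteratedFDerivWithin ℝ i f Ω z‖ ≤ L

variable [FiniteDimensional ℝ E]

/-- `π_y`: the orthogonal projection onto the tangent space at `y`, with `y` as the origin. -/
def tangentProj (M : Set E) (y : E) : E → tangentSpace M y :=
  fun x => (tangentSpace M y).orthogonalProjectionOnto (x - y)

/-- `Φ_y`: the inverse of the restriction of `π_y` to `M ∩ B(y, τ/4)`, where `τ` is the reach of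
`M`. -/
def inverseProj (M : Set E) (y : E) : tangentSpace M y → E :=
  Function.invFunOn (tangentProj M y) (M ∩ eball y (reach M / 4))

/-- The regularity assumption on the manifold `M`: it is a compact `C^β` submanifold of dimension
`d ≥ 3`, its reach `τ` exceeds `τmin > 0`, and all inverse projections `Φ_y` have `C^β` norm at
most `L` on the ball of radius `τ/8` centred at `0` in `T_y M`. -/
structure RegularManifold (d β : ℕ) (τmin L : ℝ) (M : Set E) : Prop where
  dim_ge : 3 ≤ d
  isCompact : IsCompact M
  smooth : IsSmoothSubmanifold d β M
  τmin_pos : 0 < τmin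
  reach_gt : ENNReal.ofReal τmin < reach M
  L_pos : 0 < L
  norm_le : ∀ y ∈ M,
    CkNormLE β (eball (0 : tangentSpace M y) (reach M / 8)) (inverseProj M y) L

/-- `r₀ = min (1, τ, L⁻¹) / 8`, where `τ` is the reach of `M`. -/
def r₀ (M : Set E) (L : ℝ) : ℝ :=
  min (min 1 (reach M)).toReal L⁻¹ / 8

/-- The `d`-dimensional volume of `M`: its Hausdorff measure, normalized so that it is the Lebesgue
measure on `d`-dimensional Euclidean spaces. -/
def vol [MeasurableSpace E] [BorelSpace E] (d : ℕ) (M : Set E) : ℝ :=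
  (Measure.euclideanHausdorffMeasure d : Measure E).real M

end ManifoldNoise

end

noncomputable section

namespace ManifoldNoise

/-! ### Gaussian tails and chaining -/

section Gaussian

variable {E : Type*} [NormedAddCommGroup E] [InnerProductSpace ℝ E] [FiniteDimensional ℝ E]
  [MeasurableSpace E] [BorelSpace E] {Ω : Type*} [MeasurableSpace Ω] {P : Measure Ω}
  {Z : Ω → E}

/-! The norm of the projection of `Z` to `T_yM` is the supremum of `⟪v, Z⟫` over unit vectors `v` of
`T_yM`. The theorem is thus a bound on the supremum of a Gaussian process indexed by all unit
tangent vectors of `M`. Chaining (`one_sub_le_measureReal_forall_inner_le`) gives `8 √W` once there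
are nets at scale `4 ^ (-k) / 4` with at most `exp ((k + 2) W)` points; the theorem's `W` contains
`log δ⁻¹`, so the same `W` pays for the probability.

The nets (`exists_tangent_net`) combine a net of `M` with nets of the unit balls of the tangent
spaces at its points. Two facts are needed. Small balls of `M` have volume bounded below
(`pow_le_measure`), because the 1-Lipschitz projection to `T_yM` maps them onto sets containing flat
balls. Tangent spaces vary in a Lipschitz way (`norm_sub_projection_le`), because `T_qM` is the
range of the derivative of `Φ_y`, whose second derivative is bounded by `L`.

Both rest on local geometry that the hypotheses give only indirectly. `Φ_y` is a choice of preimages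
with a default value, so it must be shown to be a true section of the projection
(`inverseProj_spec`, by connectedness). The reach then shows that `M` is exactly the graph of `Φ_y`
near `y`: balls tangent to `M` of radius below the reach do not meet `M`, which excludes a second
sheet (`norm_normal_le`, `inverseProj_tangentProj`). -/

lemma hasSubgaussianMGF_inner_stdGaussian (hZ : HasLaw Z (stdGaussian E) P) (w : E) :
    HasSubgaussianMGF (fun ω => inner ℝ w (Z ω)) (‖w‖₊ ^ 2) P := by
  have hmap : P.map (fun ω => inner ℝ w (Z ω)) = gaussianReal 0 (‖w‖₊ ^ 2) := by
    have h1 : P.map (fun ω => inner ℝ w (Z ω)) = (P.map Z).map (innerSL ℝ w) := by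
      rw [AEMeasurable.map_map_of_aemeasurable (by fun_prop) hZ.aemeasurable]
      rfl
    rw [h1, hZ.map_eq, IsGaussian.map_eq_gaussianReal, integral_strongDual_stdGaussian,
      variance_dual_stdGaussian]
    congr 1
    ext
    simp
  have hm : AEMeasurable (fun ω => inner ℝ w (Z ω)) P :=
    (by fun_prop : AEMeasurable (innerSL ℝ w) (P.map Z)).comp_aemeasurable hZ.aemeasurable
  refine ⟨fun t => ?_, fun t => ?_⟩
  · have := integrable_exp_mul_gaussianReal (μ := 0) (v := ‖w‖₊ ^ 2) t
    rw [← hmap] at this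
    exact (integrable_map_measure (by fun_prop) hm).1 this
  · rw [mgf_gaussianReal hmap]
    simp

/-- The deviation is only bounded by `σ`, so that one `σ > 0` serves all links of a level, including
zero vectors. -/
lemma measureReal_le_inner_stdGaussian [IsProbabilityMeasure P]
    (hZ : HasLaw Z (stdGaussian E) P) {w : E} {σ u : ℝ} (hσ : 0 < σ) (hw : ‖w‖ ≤ σ) (hu : 0 ≤ u) :
    P.real {ω | σ * u ≤ inner ℝ w (Z ω)} ≤ Real.exp (-u ^ 2 / 2) := by
  have h := hasSubgaussianMGF_inner_stdGaussian hZ w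
  have h' : HasSubgaussianMGF (fun ω => inner ℝ w (Z ω)) (σ.toNNReal ^ 2) P := by
    refine ⟨h.integrable_exp_mul, fun t => (h.mgf_le t).trans ?_⟩
    have : ‖w‖ ^ 2 ≤ σ ^ 2 := by gcongr
    simp only [NNReal.coe_pow, coe_nnnorm, Real.coe_toNNReal _ hσ.le]
    gcongr
  refine (h'.measure_ge_le (by positivity)).trans_eq ?_
  congr 1
  simp only [NNReal.coe_pow, Real.coe_toNNReal _ hσ.le]
  field_simp

/-- Chaining bound for the supremum of the Gaussian process `v ↦ ⟪v, Z⟫` over an index set `S`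
with nets `T k` at the scales `4 ^ (-k)`. -/
theorem one_sub_le_measureReal_forall_inner_le [IsProbabilityMeasure P]
    (hZ : HasLaw Z (stdGaussian E) P) {S : Set E}
    (T : ℕ → Finset E) {W δ : ℝ} (hW : Real.exp (-W) ≤ 1 / 2) (hδ : Real.exp (-W) ≤ δ)
    (hcard : ∀ k, ((T k).card : ℝ) ≤ Real.exp ((k + 2) * W))
    (hT : ∀ w ∈ T 0, ‖w‖ ≤ 1)
    (hnet : ∀ v ∈ S, ∀ k, ∃ w ∈ T k, ‖v - w‖ ≤ (1 / 4) ^ k / 4) :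
    1 - δ ≤ P.real {ω | ∀ v ∈ S, inner ℝ v (Z ω) ≤ 8 * √W} := by
  classical
  have hWpos : 0 < W := by
    by_contra! h
    have := Real.one_le_exp (neg_nonneg.2 h)
    linarith
  have hδ0 : 0 < δ := (Real.exp_pos _).trans_le hδ
  set s := √W with hs
  have hss : s ^ 2 = W := Real.sq_sqrt hWpos.le
  have hs0 : 0 ≤ s := Real.sqrt_nonneg _
  set B₀ : Set Ω := ⋃ w ∈ T 0, {ω | 1 * (3 * s) ≤ inner ℝ w (Z ω)} with hB₀
  -- Links between consecutive nets have length at most `4 ^ (-k) / 4 + 4 ^ (-k-1) / 4 = 5/16 * 4 ^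
  -- (-k)`. The level `6 * 2 ^ k * s` below still gives summable increments `15/8 * 2 ^ (-k) * s`,
  -- while its Gaussian exponent `18 * 4 ^ k * W` beats the `(2k + 5) W` from the number of pairs.
  set F : ℕ → Finset (E × E) := fun k =>
    (T k ×ˢ T (k + 1)).filter (fun p => ‖p.2 - p.1‖ ≤ 5 / 16 * (1 / 4) ^ k) with hF
  set B : ℕ → Set Ω := fun k => ⋃ p ∈ F k,
    {ω | (5 / 16 * (1 / 4) ^ k) * (6 * 2 ^ k * s) ≤ inner ℝ (p.2 - p.1) (Z ω)} with hB
  have hP₀ : P.real B₀ ≤ δ * (1 / 2) := by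
    refine (measureReal_biUnion_finset_le _ _).trans ?_
    refine (Finset.sum_le_card_nsmul _ _ (Real.exp (-(3 * s) ^ 2 / 2)) fun w hw =>
      measureReal_le_inner_stdGaussian hZ one_pos (hT w hw) (by positivity)).trans ?_
    rw [nsmul_eq_mul]
    calc ((T 0).card : ℝ) * Real.exp (-(3 * s) ^ 2 / 2)
        ≤ Real.exp (((0 : ℕ) + 2) * W) * Real.exp (-(3 * s) ^ 2 / 2) := by gcongr; exact hcard 0
      _ = Real.exp (-(5 / 2) * W) := by
        rw [← Real.exp_add]; congr 1; rw [mul_pow, hss]; push_cast; ring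
      _ ≤ Real.exp (-W + -W) := by gcongr; linarith
      _ = Real.exp (-W) * Real.exp (-W) := Real.exp_add _ _
      _ ≤ δ * (1 / 2) := by gcongr
  have hPk : ∀ k, P.real (B k) ≤ δ * (1 / 4) * (1 / 2) ^ k := by
    intro k
    refine (measureReal_biUnion_finset_le _ _).trans ?_
    refine (Finset.sum_le_card_nsmul _ _ (Real.exp (-(6 * 2 ^ k * s) ^ 2 / 2)) fun p hp =>
      measureReal_le_inner_stdGaussian hZ (by positivity) (Finset.mem_filter.1 hp).2
        (by positivity)).trans ?_
    rw [nsmul_eq_mul]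
    have hc : ((F k).card : ℝ) ≤ Real.exp ((k + 2) * W) * Real.exp (((k + 1 : ℕ) + 2) * W) := by
      refine (Nat.cast_le.2 (Finset.card_filter_le _ _)).trans ?_
      rw [Finset.card_product, Nat.cast_mul]
      gcongr
      · exact hcard k
      · exact hcard (k + 1)
    have h4 : (k : ℝ) + 1 ≤ 4 ^ k := by
      have := one_add_mul_le_pow (a := (3 : ℝ)) (by norm_num) k
      norm_num at this
      nlinarith [(Nat.cast_nonneg k : (0 : ℝ) ≤ k)]
    have h24 : ((2 : ℝ) ^ k) ^ 2 = 4 ^ k := by rw [← pow_mul, mul_comm, pow_mul]; norm_num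
    calc ((F k).card : ℝ) * Real.exp (-(6 * 2 ^ k * s) ^ 2 / 2)
        ≤ Real.exp ((k + 2) * W) * Real.exp (((k + 1 : ℕ) + 2) * W)
          * Real.exp (-(6 * 2 ^ k * s) ^ 2 / 2) := by gcongr
      _ = Real.exp ((2 * k + 5 - 18 * 4 ^ k) * W) := by
        rw [← Real.exp_add, ← Real.exp_add]; congr 1
        rw [mul_pow, mul_pow, hss, h24]; push_cast; ring
      _ ≤ Real.exp (-W + (k + 2 : ℕ) * -W) := by
        gcongr
        push_cast
        nlinarith [(Nat.cast_nonneg k : (0 : ℝ) ≤ k)]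
      _ = Real.exp (-W) * Real.exp (-W) ^ (k + 2) := by
        rw [Real.exp_add, Real.exp_nat_mul]
      _ ≤ δ * (1 / 2) ^ (k + 2) := by gcongr
      _ = δ * (1 / 4) * (1 / 2) ^ k := by ring
  have hPU : P.real (⋃ k, B k) ≤ δ * (1 / 2) := by
    have hsum : HasSum (fun k : ℕ => δ * (1 / 4) * (1 / 2 : ℝ) ^ k) (δ * (1 / 2)) := by
      have := (hasSum_geometric_two).mul_left (δ * (1 / 4))
      rwa [show δ * (1 / 4) * 2 = δ * (1 / 2) by ring] at this
    have h1 : P (⋃ k, B k) ≤ ∑' k, ENNReal.ofReal (δ * (1 / 4) * (1 / 2 : ℝ) ^ k) := by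
      refine (measure_iUnion_le _).trans (ENNReal.tsum_le_tsum fun k => ?_)
      rw [← ofReal_measureReal (h := measure_ne_top _ _)]
      exact ENNReal.ofReal_le_ofReal (hPk k)
    rw [← ENNReal.ofReal_tsum_of_nonneg (fun k => by positivity) hsum.summable,
      hsum.tsum_eq] at h1
    exact ENNReal.toReal_le_of_le_ofReal (by positivity) h1
  -- The good event is not known to be measurable, so the space is covered and subadditivity used
  -- instead of complements.
  have hcover : (univ : Set Ω) ⊆ {ω | ∀ v ∈ S, inner ℝ v (Z ω) ≤ 8 * s} ∪ (B₀ ∪ ⋃ k, B k) := by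
    intro ω _
    by_contra hω
    simp only [mem_union, not_or, mem_ofPred_eq, not_forall, not_le] at hω
    obtain ⟨⟨v, hv, hlt⟩, h0, hk⟩ := hω
    choose w hwT hw using hnet v hv
    -- The invariant starts at `3 s` and grows by `2 * 2 ^ (-k) * s` per step, more than the
    -- permitted increment; it stays below `7 s`.
    have hstep : ∀ k, inner ℝ (w k) (Z ω) ≤ (7 - 4 * (1 / 2) ^ k) * s := by
      intro k
      induction k with
      | zero =>
        by_contra! h
        refine h0 (mem_biUnion (hwT 0) ?_)
        simp only [mem_ofPred_eq]
        norm_num at h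
        linarith
      | succ k ih =>
        have hdiff : ‖w (k + 1) - w k‖ ≤ 5 / 16 * (1 / 4) ^ k := by
          have := norm_sub_le (v - w k) (v - w (k + 1))
          rw [sub_sub_sub_cancel_left] at this
          have h1 := hw k
          have h2 := hw (k + 1)
          rw [pow_succ] at h2
          linarith
        have hlt2 : inner ℝ (w (k + 1) - w k) (Z ω) <
            (5 / 16 * (1 / 4) ^ k) * (6 * 2 ^ k * s) := by
          by_contra! h
          refine hk (mem_iUnion.2 ⟨k, mem_biUnion (x := (w k, w (k + 1))) ?_ h⟩)
          simp only [hF, Finset.coe_filter, Finset.mem_product, mem_ofPred_eq]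
          exact ⟨⟨hwT k, hwT (k + 1)⟩, hdiff⟩
        rw [inner_sub_left] at hlt2
        have h42 : ((1 : ℝ) / 4) ^ k * 2 ^ k = (1 / 2) ^ k := by
          rw [← mul_pow]; norm_num
        have h3 : (5 / 16 * (1 / 4 : ℝ) ^ k) * (6 * 2 ^ k * s) = 15 / 8 * (1 / 2) ^ k * s := by
          rw [← h42]; ring
        have h4 : 0 ≤ (1 / 2 : ℝ) ^ k * s := by positivity
        rw [pow_succ]
        nlinarith
    have hlim : Filter.Tendsto w Filter.atTop (𝓝 v) := by
      rw [tendsto_iff_norm_sub_tendsto_zero]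
      have h4 : Filter.Tendsto (fun k : ℕ => (1 / 4 : ℝ) ^ k / 4) Filter.atTop (𝓝 0) := by
        have := (tendsto_pow_atTop_nhds_zero_of_lt_one (r := (1 / 4 : ℝ)) (by norm_num)
          (by norm_num)).div_const 4
        simpa using this
      exact squeeze_zero (fun _ => norm_nonneg _) (fun k => by rw [norm_sub_rev]; exact hw k) h4
    have hle : inner ℝ v (Z ω) ≤ 7 * s := by
      refine le_of_tendsto (hlim.inner tendsto_const_nhds) (Filter.Eventually.of_forall fun k => ?_)
      refine (hstep k).trans ?_
      have : 0 ≤ (1 / 2 : ℝ) ^ k * s := by positivity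
      nlinarith
    linarith
  have h1 : (1 : ℝ) ≤ P.real {ω | ∀ v ∈ S, inner ℝ v (Z ω) ≤ 8 * s} + (δ * (1 / 2) + δ * (1 / 2)) := by
    calc (1 : ℝ) = P.real univ := by simp
      _ ≤ P.real ({ω | ∀ v ∈ S, inner ℝ v (Z ω) ≤ 8 * s} ∪ (B₀ ∪ ⋃ k, B k)) :=
        measureReal_mono hcover
      _ ≤ _ := (measureReal_union_le _ _).trans (by
        gcongr
        exact (measureReal_union_le _ _).trans (by gcongr))
  linarith

end Gaussian

/-! ### Nets from volume bounds -/

section Net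

/-- A set all of whose points carry mass at least `c` in their `ε / 2`-ball within a set of mass `V`
has an `ε`-net of at most `V / c` points. -/
lemma exists_finset_net_of_le_measure {X : Type*} [MetricSpace X] [MeasurableSpace X]
    [OpensMeasurableSpace X] (μ : Measure X) {A B : Set X} {ε c : ℝ} (hε : 0 < ε) (hc : 0 < c)
    (hB : μ B ≠ ⊤) (h : ∀ x ∈ A, ENNReal.ofReal c ≤ μ (ball x (ε / 2) ∩ B)) :
    ∃ F : Finset X, (F : Set X) ⊆ A ∧ (∀ x ∈ A, ∃ y ∈ F, dist x y ≤ ε) ∧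
      F.card * c ≤ μ.real B := by
  have hcard : ∀ F : Finset X, (F : Set X) ⊆ A → IsSeparated (ENNReal.ofReal ε) (F : Set X) →
      F.card * c ≤ μ.real B := by
    intro F hFA hF
    have hdis : (F : Set X).PairwiseDisjoint (fun x => ball x (ε / 2)) := by
      intro x hx y hy hxy
      have : ENNReal.ofReal ε < edist x y := hF hx hy hxy
      rw [edist_dist, ENNReal.ofReal_lt_ofReal_iff_of_nonneg hε.le] at this
      exact ball_disjoint_ball (by linarith)
    have h1 : ∑ x ∈ F, μ (ball x (ε / 2) ∩ B) ≤ μ B := by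
      calc ∑ x ∈ F, μ (ball x (ε / 2) ∩ B)
          = ∑ x ∈ F, μ.restrict B (ball x (ε / 2)) :=
            Finset.sum_congr rfl fun x _ => (Measure.restrict_apply measurableSet_ball).symm
        _ = μ.restrict B (⋃ x ∈ F, ball x (ε / 2)) :=
            (measure_biUnion_finset hdis fun _ _ => measurableSet_ball).symm
        _ ≤ μ.restrict B univ := measure_mono (subset_univ _)
        _ = μ B := by simp
    have h2 : F.card • ENNReal.ofReal c ≤ μ B :=
      (Finset.card_nsmul_le_sum _ _ _ fun x hx => h x (hFA hx)).trans h1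
    have h3 := ENNReal.toReal_mono hB h2
    simpa [ENNReal.toReal_ofReal hc.le, measureReal_def] using h3
  set ε' : NNReal := ε.toNNReal with hε'
  have hεε : (ε' : ℝ≥0∞) = ENNReal.ofReal ε := rfl
  have hpack : packingNumber ε' A ≠ ⊤ := by
    have : packingNumber ε' A ≤ (⌊μ.real B / c⌋₊ : ℕ∞) := by
      refine iSup₂_le fun C hCA => iSup_le fun hC => ?_
      by_contra! hlt
      -- `C` may be infinite; one point more than the bound allows is enough for a contradiction.
      obtain ⟨D, hDC, hD⟩ := exists_subset_encard_eq (Order.add_one_le_of_lt hlt)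
      have hDfin : D.Finite := finite_of_encard_eq_coe (k := ⌊μ.real B / c⌋₊ + 1) (by simpa using hD)
      have h1 := hcard hDfin.toFinset (by simpa using hDC.trans hCA) (by
        rw [← hεε]; simpa using hC.subset hDC)
      have h2 : hDfin.toFinset.card = ⌊μ.real B / c⌋₊ + 1 := by
        rw [hDfin.encard_eq_coe_toFinset_card] at hD
        exact_mod_cast hD
      rw [h2, ← le_div_iff₀ hc] at h1
      have := Nat.lt_floor_add_one (μ.real B / c)
      push_cast at h1
      linarith
    exact ne_top_of_le_ne_top (by simp) this
  have hfin : (maximalSeparatedSet ε' A).Finite := by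
    rw [← encard_ne_top_iff, encard_maximalSeparatedSet hpack]
    exact hpack
  refine ⟨hfin.toFinset, by simpa using maximalSeparatedSet_subset, fun x hx => ?_,
    hcard _ (by simpa using maximalSeparatedSet_subset) ?_⟩
  · obtain ⟨y, hy, hxy⟩ := isCover_maximalSeparatedSet hpack hx
    refine ⟨y, by simpa using hy, ?_⟩
    simp only [mem_ofPred_eq, hεε] at hxy
    rw [edist_dist, ENNReal.ofReal_le_ofReal_iff hε.le] at hxy
    exact hxy
  · rw [← hεε]
    simpa using isSeparated_maximalSeparatedSet

variable {V : Type*} [NormedAddCommGroup V] [InnerProductSpace ℝ V] [FiniteDimensional ℝ V]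
  [MeasurableSpace V] [BorelSpace V]

/-- Disjoint balls of radius `η / 2` centred in the unit ball lie in the ball of radius `1 + η / 2`;
compare volumes. -/
lemma exists_finset_net_closedBall {η : ℝ} (hη : 0 < η) :
    ∃ F : Finset V, (∀ w ∈ F, ‖w‖ ≤ 1) ∧ (∀ v : V, ‖v‖ ≤ 1 → ∃ w ∈ F, ‖v - w‖ ≤ η) ∧
      (F.card : ℝ) ≤ (1 + 2 / η) ^ Module.finrank ℝ V := by
  have hb : 0 < (volume : Measure V).real (ball (0 : V) 1) :=
    ENNReal.toReal_pos (measure_ball_pos _ _ one_pos).ne' measure_ball_lt_top.ne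
  have hball : ∀ (x : V) {r : ℝ}, 0 < r → volume (ball x r) =
      ENNReal.ofReal (r ^ Module.finrank ℝ V * (volume : Measure V).real (ball (0 : V) 1)) := by
    intro x r hr
    rw [Measure.addHaar_ball_of_pos _ _ hr, ENNReal.ofReal_mul (by positivity),
      ofReal_measureReal (h := measure_ball_lt_top.ne)]
  obtain ⟨F, hF1, hF2, hF3⟩ := exists_finset_net_of_le_measure (volume : Measure V)
    (A := closedBall 0 1) (B := ball 0 (1 + η / 2)) (ε := η)
    (c := (η / 2) ^ Module.finrank ℝ V * (volume : Measure V).real (ball (0 : V) 1))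
    hη (by positivity) measure_ball_lt_top.ne (fun x hx => by
      have hsub : ball x (η / 2) ⊆ ball 0 (1 + η / 2) :=
        ball_subset_ball' (by rw [mem_closedBall] at hx; linarith)
      rw [inter_eq_left.2 hsub, hball x (by positivity)])
  refine ⟨F, fun w hw => by simpa using hF1 hw, fun v hv => ?_, ?_⟩
  · obtain ⟨y, hy, h⟩ := hF2 v (by simpa using hv)
    exact ⟨y, hy, by rwa [← dist_eq_norm]⟩
  · rw [measureReal_def (s := ball 0 (1 + η / 2)), hball _ (by positivity), ENNReal.toReal_ofReal (by positivity),
      ← mul_assoc, mul_le_mul_iff_left₀ hb, ← le_div_iff₀ (by positivity), ← div_pow] at hF3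
    refine hF3.trans_eq ?_
    congr 1
    field_simp
    ring

/-- A crude bound: `Γ(n/2 + 1) ≤ n! ≤ n ^ n`, and the powers of `√π` are dropped. Dimension at least
2 puts `n/2 + 1` where `Γ` is monotone. -/
lemma pow_div_finrank_le_volume_ball (hV : 2 ≤ Module.finrank ℝ V) (x : V) {r : ℝ} (hr : 0 ≤ r) :
    ENNReal.ofReal ((r / Module.finrank ℝ V) ^ Module.finrank ℝ V) ≤ volume (ball x r) := by
  have : Nontrivial V := Module.nontrivial_of_finrank_pos (R := ℝ) (by omega)
  set n := Module.finrank ℝ V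
  have hn : (2 : ℝ) ≤ n := by exact_mod_cast hV
  rw [InnerProductSpace.volume_ball, div_pow, div_eq_mul_inv, ENNReal.ofReal_mul (by positivity),
    ENNReal.ofReal_pow hr]
  gcongr
  rw [inv_eq_one_div]
  have hG : Real.Gamma (n / 2 + 1) ≤ n ^ n := by
    calc Real.Gamma (n / 2 + 1) ≤ Real.Gamma (n + 1) :=
          Real.Gamma_strictMonoOn_Ici.monotoneOn (by simp; linarith) (by simp; linarith)
            (by linarith)
      _ = (n.factorial : ℝ) := Real.Gamma_nat_eq_factorial n
      _ ≤ n ^ n := by exact_mod_cast Nat.factorial_le_pow n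
  have hG0 : 0 < Real.Gamma ((n : ℝ) / 2 + 1) := Real.Gamma_pos_of_pos (by positivity)
  gcongr
  exact one_le_pow₀ (Real.one_le_sqrt.2 (by linarith [Real.pi_gt_three]))

end Net

/-! ### Reach and tangent balls -/

section Reach

variable {E : Type*} [NormedAddCommGroup E] {M : Set E}

lemma exists_unique_dist_eq_infDist (hne : M.Nonempty) {x : E}
    (hx : ENNReal.ofReal (infDist x M) < reach M) :
    ∃! y : E, y ∈ M ∧ dist x y = infDist x M := by
  obtain ⟨ε, hε, hlt⟩ := lt_sSup_iff.1 hx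
  have hinf : infEDist x M = ENNReal.ofReal (infDist x M) :=
    (ENNReal.ofReal_toReal (infEDist_ne_top hne)).symm
  have h := hε x (hinf ▸ hlt)
  simpa only [hinf, edist_dist, ENNReal.ofReal_eq_ofReal_iff dist_nonneg infDist_nonneg] using h

/-- A nearest point is stable under small perturbations if it is unique. -/
lemma eventually_dist_lt_of_unique_nearest (hM : IsCompact M) {x p : E}
    (hp : ∀ q ∈ M, dist x q = infDist x M → q = p) {ε : ℝ} (hε : 0 < ε) :
    ∀ᶠ z in 𝓝 x, ∀ q ∈ M, dist z q = infDist z M → dist q p < ε := by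
  set K := M \ ball p ε with hK
  have hKc : IsCompact K := hM.diff isOpen_ball
  rcases K.eq_empty_or_nonempty with hKe | hKne
  · refine Filter.Eventually.of_forall fun z q hq _ => ?_
    by_contra h
    exact (hKe ▸ (show q ∈ K from ⟨hq, h⟩) : q ∈ (∅ : Set E))
  · have hlt : infDist x M < infDist x K := by
      obtain ⟨q, hq, hxq⟩ := hKc.exists_infDist_eq_dist hKne x
      refine lt_of_le_of_ne (infDist_le_infDist_of_subset sdiff_subset hKne) fun h => ?_
      have := hp q hq.1 (by rw [h, hxq])
      exact hq.2 (by simpa [this] using hε)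
    have := (continuous_infDist_pt M).continuousAt.eventually_lt
      (continuous_infDist_pt K).continuousAt hlt
    filter_upwards [this] with z hz q hq hzq
    by_contra h
    have := infDist_le_dist_of_mem (x := z) (show q ∈ K from ⟨hq, h⟩)
    linarith

variable [InnerProductSpace ℝ E]

/-- Moving away from the unique nearest point, the distance to `M` grows at unit speed. -/
lemma eventually_add_mul_le_infDist (hM : IsCompact M) (hne : M.Nonempty) {x p : E}
    (hxp : dist x p = infDist x M) (hx : 0 < infDist x M)
    (hp : ∀ q ∈ M, dist x q = infDist x M → q = p) {c : ℝ} (hc0 : 0 ≤ c) (hc : c < 1) :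
    ∀ᶠ h in 𝓝[>] (0 : ℝ), infDist x M + c * h ≤
      infDist (x + h • ((infDist x M)⁻¹ • (x - p))) M := by
  set f := infDist x M with hf
  set ν := f⁻¹ • (x - p) with hν
  have hνn : ‖ν‖ = 1 := by
    rw [hν, norm_smul, ← dist_eq_norm, hxp, Real.norm_of_nonneg (by positivity)]
    field_simp
  have hνi : inner ℝ ν (x - p) = f := by
    rw [hν, real_inner_smul_left, real_inner_self_eq_norm_sq, ← dist_eq_norm, hxp]
    field_simp
  have hcont : Filter.Tendsto (fun h : ℝ => x + h • ν) (𝓝[>] 0) (𝓝 x) := by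
    have : Continuous fun h : ℝ => x + h • ν := by fun_prop
    simpa using (this.tendsto 0).mono_left nhdsWithin_le_nhds
  -- A nearest point `q` within `(1 - c) * f` of `p` satisfies `⟪ν, x - q⟫ ≥ c * f`, which yields
  -- slope `c`.
  filter_upwards [hcont.eventually (eventually_dist_lt_of_unique_nearest hM hp
    (mul_pos (sub_pos.2 hc) hx)), self_mem_nhdsWithin] with h hh hpos
  rw [mem_Ioi] at hpos
  obtain ⟨q, hq, hqd⟩ := hM.exists_infDist_eq_dist hne (x + h • ν)
  have hqp := hh q hq hqd.symm
  rw [hqd, dist_eq_norm]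
  refine le_of_sq_le_sq ?_ (norm_nonneg _)
  have h1 : f ≤ ‖x - q‖ := by rw [← dist_eq_norm]; exact infDist_le_dist_of_mem hq
  have h2 : ‖x + h • ν - q‖ ^ 2 = ‖x - q‖ ^ 2 + 2 * (h * inner ℝ ν (x - q)) + h ^ 2 := by
    rw [show x + h • ν - q = (x - q) + h • ν by abel, norm_add_sq_real, real_inner_smul_right,
      real_inner_comm, norm_smul, hνn, mul_one, Real.norm_eq_abs, sq_abs]
  have h3 : c * f ≤ inner ℝ ν (x - q) := by
    rw [show x - q = (x - p) - (q - p) by abel, inner_sub_right, hνi]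
    have := real_inner_le_norm ν (q - p)
    rw [hνn, one_mul, ← dist_eq_norm] at this
    nlinarith
  have h4 : f ^ 2 ≤ ‖x - q‖ ^ 2 := by gcongr
  rw [h2]
  have h5 : h * (c * f) ≤ h * inner ℝ ν (x - q) := by gcongr
  have h6 : c ^ 2 * h ^ 2 ≤ 1 * h ^ 2 := by gcongr; nlinarith
  nlinarith

variable [FiniteDimensional ℝ E]

/-- Within the reach the distance function to `M` can be increased at unit speed. -/
lemma exists_add_le_infDist (hM : IsCompact M) (hne : M.Nonempty) {x₀ : E} {S : ℝ} (hS : 0 ≤ S)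
    (hx₀ : 0 < infDist x₀ M) (hlt : ENNReal.ofReal (infDist x₀ M + S) < reach M) :
    ∃ x₁ ∈ closedBall x₀ S, infDist x₀ M + S ≤ infDist x₁ M := by
  have hslope : ∀ c : ℝ, 0 ≤ c → c < 1 →
      ∃ x ∈ closedBall x₀ S, infDist x₀ M + c * S ≤ infDist x M := by
    intro c hc0 hc
    -- A maximizer of the penalized distance lies on the sphere of radius `S`, where the penalty
    -- gives the claim: at an interior one the distance to `M` could still grow at slope `(1 + c) /
    -- 2 > c`.
    obtain ⟨x, hx, hmax⟩ := (isCompact_closedBall x₀ S).exists_isMaxOn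
      ⟨x₀, mem_closedBall_self hS⟩
      (f := fun x => infDist x M - c * dist x x₀) (by fun_prop)
    refine ⟨x, hx, ?_⟩
    have h0 := hmax (mem_closedBall_self hS)
    simp only [mem_ofPred_eq, dist_self, mul_zero, sub_zero] at h0
    rcases (mem_closedBall.1 hx).eq_or_lt with h | h
    · rw [h] at h0; linarith
    · exfalso
      have hxpos : 0 < infDist x M := by nlinarith [dist_nonneg (x := x) (y := x₀)]
      have hxle : infDist x M ≤ infDist x₀ M + S :=
        (infDist_le_infDist_add_dist (y := x₀)).trans (by linarith)
      obtain ⟨p, ⟨hpM, hxp⟩, hp⟩ := exists_unique_dist_eq_infDist hne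
        ((ENNReal.ofReal_le_ofReal hxle).trans_lt hlt)
      have hc' : (1 + c) / 2 < 1 := by linarith
      have hev := eventually_add_mul_le_infDist hM hne hxp hxpos (fun q hq h => hp q ⟨hq, h⟩)
        (by linarith : 0 ≤ (1 + c) / 2) hc'
      have hsmall : ∀ᶠ h in 𝓝[>] (0 : ℝ), h < S - dist x x₀ :=
        nhdsWithin_le_nhds (eventually_lt_nhds (by linarith))
      obtain ⟨h, h1, h2, h3⟩ := (hev.and (hsmall.and self_mem_nhdsWithin)).exists
      replace h3 : 0 < h := h3
      set ν := (infDist x M)⁻¹ • (x - p) with hν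
      have hνn : ‖ν‖ = 1 := by
        rw [hν, norm_smul, ← dist_eq_norm, hxp, Real.norm_of_nonneg (by positivity)]
        field_simp
      have hd : dist (x + h • ν) x₀ ≤ dist x x₀ + h := by
        refine (dist_triangle _ x _).trans_eq ?_
        rw [dist_eq_norm, add_sub_cancel_left, norm_smul, hνn, Real.norm_of_nonneg h3.le]
        ring
      have h4 := hmax (show x + h • ν ∈ closedBall x₀ S from mem_closedBall.2 (by linarith))
      simp only [mem_ofPred_eq] at h4
      have h5 : c * dist (x + h • ν) x₀ ≤ c * (dist x x₀ + h) := by gcongr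
      nlinarith
  obtain ⟨x₁, hx₁, hmax⟩ := (isCompact_closedBall x₀ S).exists_isMaxOn
    ⟨x₀, mem_closedBall_self hS⟩ (f := fun x => infDist x M) (by fun_prop)
  refine ⟨x₁, hx₁, ?_⟩
  have hle : ∀ c ∈ Ico (0 : ℝ) 1, infDist x₀ M + c * S ≤ infDist x₁ M := by
    rintro c ⟨hc0, hc1⟩
    obtain ⟨x, hx, h⟩ := hslope c hc0 hc1
    exact h.trans (hmax hx)
  have hcl : (1 : ℝ) ∈ closure (Ico (0 : ℝ) 1) := by
    rw [closure_Ico (by norm_num)]; simp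
  have := closure_minimal (t := {c : ℝ | infDist x₀ M + c * S ≤ infDist x₁ M}) hle
    (isClosed_le (by fun_prop) (by fun_prop)) hcl
  simpa using this

/-- If `y` is a nearest point of `y + t₀ n`, it remains a nearest point of `y + t n` up to the
reach. -/
lemma le_dist_add_smul_of_lt_reach (hM : IsCompact M) {y n : E} (hy : y ∈ M) (hn : ‖n‖ = 1)
    {t₀ t : ℝ} (ht₀ : 0 < t₀) (h₀ : infDist (y + t₀ • n) M = t₀) (ht : t₀ ≤ t)
    (hlt : ENNReal.ofReal t < reach M) {q : E} (hq : q ∈ M) : t ≤ dist (y + t • n) q := by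
  obtain ⟨x₁, hx₁, h₁⟩ := exists_add_le_infDist hM ⟨y, hy⟩ (x₀ := y + t₀ • n) (S := t - t₀)
    (by linarith) (by rw [h₀]; exact ht₀) (by rw [h₀, add_sub_cancel]; exact hlt)
  rw [h₀, add_sub_cancel] at h₁
  -- `x₁` is within `t - t₀` of `y + t₀ n` and at least `t` from `y`; equality in the triangle
  -- inequality leaves only `y + t n`.
  suffices h : x₁ = y + t • n by
    rw [← h]; exact h₁.trans (infDist_le_dist_of_mem hq)
  set e := x₁ - (y + t₀ • n) with he
  have he1 : ‖e‖ ≤ t - t₀ := by rw [he, ← dist_eq_norm]; exact hx₁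
  have he2 : t ≤ ‖e + t₀ • n‖ := by
    rw [he, show x₁ - (y + t₀ • n) + t₀ • n = x₁ - y by abel, ← dist_eq_norm]
    exact h₁.trans (infDist_le_dist_of_mem hy)
  have he3 : t ^ 2 ≤ ‖e + t₀ • n‖ ^ 2 := by gcongr; linarith
  rw [norm_add_sq_real, real_inner_smul_right, norm_smul, hn, mul_one, Real.norm_of_nonneg ht₀.le]
    at he3
  have he4 : ‖e‖ ^ 2 ≤ (t - t₀) ^ 2 := by gcongr
  have he5 : t - t₀ ≤ inner ℝ e n := by nlinarith
  have he6 : ‖e - (t - t₀) • n‖ ^ 2 ≤ 0 := by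
    rw [norm_sub_sq_real, real_inner_smul_right, norm_smul, hn, mul_one,
      Real.norm_of_nonneg (by linarith)]
    nlinarith
  have he7 : e - (t - t₀) • n = 0 := by
    rw [← norm_eq_zero]; exact pow_eq_zero_iff two_ne_zero |>.1 (le_antisymm he6 (sq_nonneg _))
  rw [he, sub_smul] at he7
  rw [← sub_eq_zero, ← he7]
  abel

/-- If `M` stays quadratically close to its tangent space at `y`, then `M` avoids the open balls of
radius smaller than the reach tangent to `M` at `y`. -/
lemma le_dist_add_smul_of_quadratic (hM : IsCompact M) {y n : E} (hy : y ∈ M) (hn : ‖n‖ = 1)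
    {C : ℝ} (hC : ∀ᶠ q in 𝓝[M] y, inner ℝ (q - y) n ≤ C * ‖q - y‖ ^ 2)
    {t : ℝ} (ht : 0 < t) (hlt : ENNReal.ofReal t < reach M) {q : E} (hq : q ∈ M) :
    t ≤ dist (y + t • n) q := by
  obtain ⟨ρ, hρ, hball⟩ := Metric.eventually_nhds_iff.1 (eventually_nhdsWithin_iff.1 hC)
  -- A tiny tangent ball misses `M`: near `y` by the quadratic bound, beyond `ρ` since `t₀ ≤ ρ / 2`.
  -- The previous lemma then enlarges it to radius `t`.
  set t₀ := min t (min (ρ / 2) (1 / (2 * (|C| + 1)))) with ht₀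
  have hC1 : 0 < 2 * (|C| + 1) := by positivity
  have ht₀pos : 0 < t₀ := by positivity
  have h1 : t₀ ≤ t := min_le_left _ _
  have h2 : t₀ ≤ ρ / 2 := (min_le_right _ _).trans (min_le_left _ _)
  have h3 : t₀ * (2 * (|C| + 1)) ≤ 1 := by
    rw [← le_div_iff₀ hC1]; exact (min_le_right _ _).trans (min_le_right _ _)
  refine le_dist_add_smul_of_lt_reach hM hy hn ht₀pos (le_antisymm ?_ ?_) h1 hlt hq
  · refine (infDist_le_dist_of_mem hy).trans_eq ?_
    rw [dist_eq_norm, add_sub_cancel_left, norm_smul, hn, mul_one, Real.norm_of_nonneg ht₀pos.le]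
  · rw [le_infDist ⟨y, hy⟩]
    intro p hp
    rw [dist_comm, dist_eq_norm]
    rcases lt_or_ge (dist p y) ρ with hpy | hpy
    · refine le_of_sq_le_sq ?_ (norm_nonneg _)
      have h4 := hball hpy hp
      rw [show p - (y + t₀ • n) = (p - y) - t₀ • n by abel, norm_sub_sq_real,
        real_inner_smul_right, norm_smul, hn, mul_one, Real.norm_of_nonneg ht₀pos.le]
      have h5 : t₀ * inner ℝ (p - y) n ≤ t₀ * (|C| * ‖p - y‖ ^ 2) := by
        gcongr
        exact h4.trans (by gcongr; exact le_abs_self C)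
      have h6 : t₀ * (2 * |C|) * ‖p - y‖ ^ 2 ≤ 1 * ‖p - y‖ ^ 2 := by
        gcongr; nlinarith
      nlinarith
    · have h4 : dist p y ≤ ‖p - (y + t₀ • n)‖ + t₀ := by
        rw [dist_eq_norm]
        calc ‖p - y‖ = ‖(p - (y + t₀ • n)) + t₀ • n‖ := by congr 1; abel
          _ ≤ _ := norm_add_le _ _
          _ = _ := by rw [norm_smul, hn, mul_one, Real.norm_of_nonneg ht₀pos.le]
      linarith

end Reach

lemma _root_.LipschitzOnWith.euclideanHausdorffMeasure_image_le {X Y : Type*} [MetricSpace X]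
    [MetricSpace Y] [MeasurableSpace X] [BorelSpace X] [MeasurableSpace Y] [BorelSpace Y]
    {K : NNReal} {f : X → Y} {s : Set X} (h : LipschitzOnWith K f s) (d : ℕ) :
    Measure.euclideanHausdorffMeasure d (f '' s) ≤
      (K : ℝ≥0∞) ^ d * Measure.euclideanHausdorffMeasure d s := by
  have := h.hausdorffMeasure_image_le (d := d) (Nat.cast_nonneg d)
  rw [ENNReal.rpow_natCast] at this
  rw [Measure.euclideanHausdorffMeasure_def, Measure.euclideanHausdorffMeasure_def,
    Measure.smul_apply, Measure.smul_apply, ENNReal.smul_def, ENNReal.smul_def, smul_eq_mul,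
    smul_eq_mul, mul_left_comm]
  gcongr

/-! ### Consequences of local parametrizations -/

section Chart

variable {E : Type*} [NormedAddCommGroup E] [InnerProductSpace ℝ E] {M : Set E} {d β : ℕ} {y : E}

lemma IsSmoothSubmanifold.exists_chart (hM : IsSmoothSubmanifold d β M) (hy : y ∈ M) :
    ∃ Ψ : EuclideanSpace ℝ (Fin d) → E, Ψ 0 = y ∧ ContDiffAt ℝ β Ψ 0 ∧
      Function.Injective (fderiv ℝ Ψ 0) ∧ (∀ᶠ u in 𝓝 0, Ψ u ∈ M) ∧
      ∀ s ∈ 𝓝 (0 : EuclideanSpace ℝ (Fin d)), Ψ '' s ∈ 𝓝[M] y := by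
  obtain ⟨U, V, Ψ, hU, h0U, hV, h0, hC, hinj, hemb, himg⟩ := hM y hy
  refine ⟨Ψ, h0, hC.contDiffAt (hU.mem_nhds h0U), hinj 0 h0U, ?_, fun s hs => ?_⟩
  · filter_upwards [hU.mem_nhds h0U] with u hu
    exact (himg ▸ mem_image_of_mem Ψ hu : Ψ u ∈ M ∩ V).1
  · have h1 : ((↑) : U → EuclideanSpace ℝ (Fin d)) ⁻¹' s ∈ 𝓝 (⟨0, h0U⟩ : U) :=
      continuous_subtype_val.continuousAt.preimage_mem_nhds hs
    rw [hemb.nhds_eq_comap] at h1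
    obtain ⟨W, hW, hWs⟩ := Filter.mem_comap.1 h1
    simp only [h0] at hW
    have hyV : y ∈ V := by
      have : Ψ 0 ∈ M ∩ V := himg ▸ mem_image_of_mem Ψ h0U
      rw [h0] at this
      exact this.2
    filter_upwards [self_mem_nhdsWithin, nhdsWithin_le_nhds hW,
      nhdsWithin_le_nhds (hV.mem_nhds hyV)] with q hqM hqW hqV
    obtain ⟨u, hu, rfl⟩ : q ∈ Ψ '' U := himg ▸ ⟨hqM, hqV⟩
    exact ⟨u, hWs (a := ⟨u, hu⟩) hqW, rfl⟩

/-- Velocities of a parametrization of part of `M` are tangent to `M`. -/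
lemma fderiv_mem_tangentSpace {F : Type*} [NormedAddCommGroup F] [NormedSpace ℝ F] {Ψ : F → E}
    {x : F} (hΨ : DifferentiableAt ℝ Ψ x) (hmem : ∀ᶠ u in 𝓝 x, Ψ u ∈ M) (v : F) :
    fderiv ℝ Ψ x v ∈ tangentSpace M (Ψ x) := by
  refine Submodule.subset_span ⟨fun t => Ψ (x + t • v), by simp, ?_, ?_⟩
  · have h1 : HasDerivAt (fun t : ℝ => x + t • v) v 0 := by
      simpa using ((hasDerivAt_id (0 : ℝ)).smul_const v).const_add x
    have h2 : HasFDerivAt Ψ (fderiv ℝ Ψ x) (x + (0 : ℝ) • v) := by simpa using hΨ.hasFDerivAt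
    exact h2.comp_hasDerivAt (0 : ℝ) h1
  · have : Continuous fun t : ℝ => x + t • v := by fun_prop
    have h := this.tendsto 0
    simp only [zero_smul, add_zero] at h
    exact h.eventually hmem

/-- Only this inequality is immediate, as `tangentSpace` is a span of velocities of arbitrary
curves; equality comes later from Hausdorff measure. -/
lemma IsSmoothSubmanifold.le_finrank_tangentSpace [FiniteDimensional ℝ E]
    (hM : IsSmoothSubmanifold d β M) (hβ : 1 ≤ β)
    (hy : y ∈ M) : d ≤ Module.finrank ℝ (tangentSpace M y) := by
  obtain ⟨Ψ, h0, hC, hinj, hmem, -⟩ := hM.exists_chart hy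
  have hT := fderiv_mem_tangentSpace (hC.differentiableAt (by norm_cast; omega)) hmem
  rw [h0] at hT
  have h := LinearMap.finrank_le_finrank_of_injective
    (f := (fderiv ℝ Ψ 0 : EuclideanSpace ℝ (Fin d) →ₗ[ℝ] E).codRestrict (tangentSpace M y) hT)
    (fun a b hab => hinj (congrArg Subtype.val hab))
  simpa using h

/-- The projected chart has injective derivative at `0`, hence avoids `0` on a punctured
neighbourhood. This later excludes a constant inverse projection. -/
lemma IsSmoothSubmanifold.exists_tangentProj_ne_zero [FiniteDimensional ℝ E]
    (hM : IsSmoothSubmanifold d β M)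
    (hβ : 1 ≤ β) (hd : 1 ≤ d) (hy : y ∈ M) {W : Set E} (hW : W ∈ 𝓝 y) :
    ∃ q ∈ M ∩ W, tangentProj M y q ≠ 0 := by
  obtain ⟨Ψ, h0, hC, hinj, hmem, -⟩ := hM.exists_chart hy
  have hdiff := hC.differentiableAt (by norm_cast; omega)
  have hT := fderiv_mem_tangentSpace hdiff hmem
  rw [h0] at hT
  have hcomp : HasFDerivAt (fun u => tangentProj M y (Ψ u))
      ((tangentSpace M y).orthogonalProjectionOnto ∘L fderiv ℝ Ψ 0) 0 :=
    (tangentSpace M y).orthogonalProjectionOnto.hasFDerivAt.comp 0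
      (hdiff.hasFDerivAt.sub_const y)
  obtain ⟨K, -, hK⟩ := LinearMap.exists_antilipschitzWith
    (fderiv ℝ Ψ 0 : EuclideanSpace ℝ (Fin d) →ₗ[ℝ] E) (LinearMap.ker_eq_bot.2 hinj)
  have hne := hcomp.eventually_ne (c := 0) ⟨K, ContinuousLinearMap.antilipschitz_of_bound _ fun z => by
    have h1 : ‖z‖ ≤ K * ‖fderiv ℝ Ψ 0 z‖ := by simpa using hK.le_mul_dist z 0
    have h2 : (tangentSpace M y).orthogonalProjectionOnto (fderiv ℝ Ψ 0 z) =
        ⟨fderiv ℝ Ψ 0 z, hT z⟩ :=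
      Submodule.orthogonalProjectionOnto_mem_subspace_eq_self (⟨_, hT z⟩ : tangentSpace M y)
    rw [ContinuousLinearMap.comp_apply, h2]
    exact h1⟩
  have : NeZero d := ⟨by omega⟩
  have hWev : ∀ᶠ u in 𝓝 0, Ψ u ∈ W := hC.continuousAt.eventually_mem (by rwa [h0])
  obtain ⟨u, hu1, hu2, hu3⟩ := (hne.and ((hmem.and hWev).filter_mono nhdsWithin_le_nhds)).exists
  exact ⟨Ψ u, ⟨hu2, hu3⟩, hu1⟩

/-- A submanifold of class `C²` stays quadratically close to its tangent spaces. -/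
lemma IsSmoothSubmanifold.eventually_inner_le (hM : IsSmoothSubmanifold d β M) (hβ : 2 ≤ β)
    (hy : y ∈ M) {n : E} (hn : n ∈ (tangentSpace M y)ᗮ) (hn1 : ‖n‖ = 1) :
    ∃ C : ℝ, ∀ᶠ q in 𝓝[M] y, inner ℝ (q - y) n ≤ C * ‖q - y‖ ^ 2 := by
  obtain ⟨Ψ, h0, hC, hinj, hmem, himg⟩ := hM.exists_chart hy
  have hT := fderiv_mem_tangentSpace (hC.differentiableAt (by norm_cast; omega)) hmem
  rw [h0] at hT
  obtain ⟨K, hKpos, hK⟩ := LinearMap.exists_antilipschitzWith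
    (fderiv ℝ Ψ 0 : EuclideanSpace ℝ (Fin d) →ₗ[ℝ] E) (LinearMap.ker_eq_bot.2 hinj)
  have hKpos' : (0 : ℝ) < K := hKpos
  have hC2 : ContDiffAt ℝ 2 Ψ 0 := hC.of_le (by exact_mod_cast hβ)
  obtain ⟨C, s, hs, hL⟩ := (hC2.fderiv_right (m := 1) (by norm_num)).exists_lipschitzOnWith
  have hdiff : ∀ᶠ u in 𝓝 (0 : EuclideanSpace ℝ (Fin d)), DifferentiableAt ℝ Ψ u := by
    filter_upwards [hC2.eventually (by simp)] with u hu
    exact hu.differentiableAt (by norm_num)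
  obtain ⟨ρ, hρ, hball⟩ := Metric.eventually_nhds_iff.1 (hdiff.and hs)
  have hquad : ∀ u, ‖u‖ < ρ → ‖Ψ u - y - fderiv ℝ Ψ 0 u‖ ≤ C * ‖u‖ ^ 2 := by
    intro u hu
    have h := (convex_closedBall (0 : EuclideanSpace ℝ (Fin d))
      ‖u‖).norm_image_sub_le_of_norm_hasFDerivWithin_le'
      (f := Ψ) (f' := fderiv ℝ Ψ) (φ := fderiv ℝ Ψ 0) (C := C * ‖u‖) (x := 0) (y := u)
      (fun x hx => (hball (lt_of_le_of_lt hx hu)).1.hasFDerivAt.hasFDerivWithinAt)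
      (fun x hx => by
        have := hL.dist_le_mul x (hball (lt_of_le_of_lt hx hu)).2 0 (mem_of_mem_nhds hs)
        rw [dist_eq_norm] at this
        exact this.trans (by gcongr; exact hx)) (mem_closedBall_self (norm_nonneg _))
      (mem_closedBall_zero_iff.2 le_rfl)
    rw [h0, sub_zero] at h
    linarith
  have hC1 : 0 < 2 * ((C : ℝ) + 1) * K := by positivity
  -- On this ball the Taylor remainder is absorbed into the linear term, so `‖u‖ ≤ 2 K ‖Ψ u - y‖`.
  refine ⟨C * (2 * K) ^ 2, Filter.mem_of_superset
    (himg _ (ball_mem_nhds 0 (show 0 < min ρ (1 / (2 * (C + 1) * K)) by positivity))) ?_⟩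
  rintro _ ⟨u, hu, rfl⟩
  rw [mem_ball_zero_iff] at hu
  have hu1 := hquad u (hu.trans_le (min_le_left _ _))
  have hu2 := (hu.trans_le (min_le_right _ _)).le
  rw [le_div_iff₀ hC1] at hu2
  have hu3 : ‖u‖ ≤ K * ‖fderiv ℝ Ψ 0 u‖ := by simpa using hK.le_mul_dist u 0
  have hu4 : ‖fderiv ℝ Ψ 0 u‖ ≤ ‖Ψ u - y‖ + ‖Ψ u - y - fderiv ℝ Ψ 0 u‖ := by
    have := norm_sub_le (Ψ u - y) (Ψ u - y - fderiv ℝ Ψ 0 u)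
    rwa [sub_sub_cancel] at this
  have hu5 : ‖u‖ ≤ 2 * K * ‖Ψ u - y‖ := by
    have h1 : (K : ℝ) * ‖fderiv ℝ Ψ 0 u‖ ≤ K * (‖Ψ u - y‖ + C * ‖u‖ ^ 2) := by
      gcongr; linarith
    have h2 : 2 * K * (C * ‖u‖ ^ 2) ≤ ‖u‖ := by
      have h3 : (‖u‖ * (2 * (C + 1) * K)) * ‖u‖ ≤ 1 * ‖u‖ := by gcongr
      have h4 : 0 ≤ K * ‖u‖ ^ 2 := by positivity
      nlinarith
    linarith
  change inner ℝ (Ψ u - y) n ≤ C * (2 * K) ^ 2 * ‖Ψ u - y‖ ^ 2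
  have h1 : inner ℝ (Ψ u - y) n = inner ℝ (Ψ u - y - fderiv ℝ Ψ 0 u) n := by
    rw [inner_sub_left _ (fderiv ℝ Ψ 0 u), (Submodule.mem_orthogonal _ _).1 hn _ (hT u), sub_zero]
  rw [h1]
  calc inner ℝ (Ψ u - y - fderiv ℝ Ψ 0 u) n ≤ ‖Ψ u - y - fderiv ℝ Ψ 0 u‖ * ‖n‖ :=
        real_inner_le_norm _ _
    _ ≤ C * ‖u‖ ^ 2 := by rw [hn1, mul_one]; exact hu1
    _ ≤ C * (2 * K * ‖Ψ u - y‖) ^ 2 := by gcongr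
    _ = _ := by ring

/-- The open balls of radius smaller than the reach that are tangent to `M` do not meet `M`. -/
lemma IsSmoothSubmanifold.le_dist_add_smul [FiniteDimensional ℝ E]
    (hM : IsSmoothSubmanifold d β M) (hβ : 2 ≤ β)
    (hMc : IsCompact M) (hy : y ∈ M) {n : E} (hn : n ∈ (tangentSpace M y)ᗮ) (hn1 : ‖n‖ = 1)
    {t : ℝ} (ht : 0 < t) (hlt : ENNReal.ofReal t < reach M) {q : E} (hq : q ∈ M) :
    t ≤ dist (y + t • n) q := by
  obtain ⟨C, hC⟩ := hM.eventually_inner_le hβ hy hn hn1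
  exact le_dist_add_smul_of_quadratic hMc hy hn1 hC ht hlt hq

lemma IsSmoothSubmanifold.measure_ne_top [MeasurableSpace E] [BorelSpace E]
    (hM : IsSmoothSubmanifold d β M) (hβ : 1 ≤ β) (hMc : IsCompact M) :
    (Measure.euclideanHausdorffMeasure d : Measure E) M ≠ ⊤ := by
  refine (hMc.measure_lt_top_of_nhdsWithin fun y hy => ?_).ne
  obtain ⟨Ψ, h0, hC, -, -, himg⟩ := hM.exists_chart hy
  obtain ⟨K, s, hs, hL⟩ := (hC.of_le
    (by exact_mod_cast hβ : (1 : WithTop ℕ∞) ≤ β)).exists_lipschitzOnWith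
  refine ⟨Ψ '' (s ∩ ball 0 1), himg _ (Filter.inter_mem hs (ball_mem_nhds 0 one_pos)), ?_⟩
  have h2 : (Measure.euclideanHausdorffMeasure d : Measure (EuclideanSpace ℝ (Fin d)))
      (s ∩ ball 0 1) < ⊤ := by
    rw [EuclideanSpace.euclideanHausdorffMeasure_eq_volume]
    exact (measure_mono inter_subset_right).trans_lt measure_ball_lt_top
  exact ((hL.mono inter_subset_left).euclideanHausdorffMeasure_image_le d).trans_lt
    (ENNReal.mul_lt_top (by simp) h2)

end Chart

/-! ### Elementary bounds on `r₀` and derivatives -/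

section NormedSpace

variable {E : Type*} [NormedAddCommGroup E] {M : Set E}

lemma r₀_le (M : Set E) (L : ℝ) : r₀ M L ≤ 1 / 8 := by
  have h1 : (min 1 (reach M)).toReal ≤ 1 := by
    have := ENNReal.toReal_mono (by simp) (min_le_left 1 (reach M))
    simpa using this
  unfold r₀
  have := min_le_left (min 1 (reach M)).toReal L⁻¹
  linarith

lemma ofReal_r₀_le (M : Set E) (L : ℝ) : ENNReal.ofReal (r₀ M L) ≤ reach M / 8 := by
  have h1 : r₀ M L ≤ (min 1 (reach M)).toReal / 8 := by
    unfold r₀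
    gcongr
    exact min_le_left _ _
  refine (ENNReal.ofReal_le_ofReal h1).trans ?_
  rw [ENNReal.ofReal_div_of_pos (by norm_num),
    ENNReal.ofReal_toReal (ne_top_of_le_ne_top ENNReal.one_ne_top (min_le_left _ _))]
  simp only [ENNReal.ofReal_ofNat]
  gcongr
  exact min_le_right _ _

lemma edist_lt_reach_of_le {a b : E} (hpos : 0 < reach M)
    (h : edist a b ≤ reach M / 8 + reach M / 4) : edist a b < reach M := by
  rcases eq_or_ne (reach M) ⊤ with ht | ht
  · rw [ht]; exact edist_lt_top a b
  · refine h.trans_lt ?_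
    rw [← ENNReal.ofReal_toReal ht] at hpos ⊢
    have h0 := ENNReal.ofReal_pos.1 hpos
    rw [← ENNReal.ofReal_ofNat 8, ← ENNReal.ofReal_ofNat 4,
      ← ENNReal.ofReal_div_of_pos (by norm_num), ← ENNReal.ofReal_div_of_pos (by norm_num),
      ← ENNReal.ofReal_add (by positivity) (by positivity)]
    exact (ENNReal.ofReal_lt_ofReal_iff h0).2 (by linarith)

lemma convex_eball {F : Type*} [NormedAddCommGroup F] [NormedSpace ℝ F] (x : F) (r : ℝ≥0∞) :
    Convex ℝ (eball x r) := by
  rcases eq_or_ne r ⊤ with rfl | hr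
  · rw [eball_top]; exact convex_univ
  · rw [← ENNReal.ofReal_toReal hr, eball_ofReal]
    exact convex_ball _ _

lemma CkNormLE.norm_fderiv_le {F G : Type*} [NormedAddCommGroup F] [NormedSpace ℝ F]
    [NormedAddCommGroup G] [NormedSpace ℝ G] {k : ℕ} {Ω : Set F} {f : F → G} {L : ℝ}
    (h : CkNormLE k Ω f L) (hk : 1 ≤ k) (hΩ : IsOpen Ω) {z : F} (hz : z ∈ Ω) :
    ‖fderiv ℝ f z‖ ≤ L := by
  have h := h.2 1 hk z hz
  rwa [norm_iteratedFDerivWithin_one _ (hΩ.uniqueDiffWithinAt hz),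
    fderivWithin_of_isOpen hΩ hz] at h

lemma CkNormLE.norm_fderiv_sub_le {F G : Type*} [NormedAddCommGroup F] [NormedSpace ℝ F]
    [NormedAddCommGroup G] [NormedSpace ℝ G] {k : ℕ} {Ω : Set F} {f : F → G} {L : ℝ}
    (h : CkNormLE k Ω f L) (hk : 2 ≤ k) (hΩ : IsOpen Ω) (hΩc : Convex ℝ Ω) {z w : F}
    (hz : z ∈ Ω) (hw : w ∈ Ω) : ‖fderiv ℝ f z - fderiv ℝ f w‖ ≤ L * ‖z - w‖ := by
  refine hΩc.norm_image_sub_le_of_norm_fderiv_le (𝕜 := ℝ) (fun x hx => ?_) (fun x hx => ?_) hw hz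
  · have h2 : ContDiffAt ℝ 2 f x := (h.1.contDiffAt (hΩ.mem_nhds hx)).of_le (by exact_mod_cast hk)
    exact (h2.fderiv_right (m := 1) (by norm_num)).differentiableAt (by norm_num)
  · have h2 := h.2 2 hk x hx
    rwa [iteratedFDerivWithin_of_isOpen 2 hΩ hx, ← norm_iteratedFDeriv_fderiv,
      norm_iteratedFDeriv_one] at h2

lemma ball_r₀_subset [InnerProductSpace ℝ E] (M : Set E) (L : ℝ) (y : E) :
    ball (0 : tangentSpace M y) (r₀ M L) ⊆ eball 0 (reach M / 8) := by
  rw [← eball_ofReal]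
  exact eball_subset_eball (ofReal_r₀_le M L)

end NormedSpace

/-! ### The inverse projection is a genuine section -/

section InverseProj

variable {E : Type*} [NormedAddCommGroup E] [InnerProductSpace ℝ E] [FiniteDimensional ℝ E]
  {M : Set E} {d β : ℕ} {τmin L : ℝ} {y : E}

@[simp]
lemma tangentProj_self : tangentProj M y y = 0 := by simp [tangentProj]

lemma lipschitzWith_tangentProj : LipschitzWith 1 (tangentProj M y) := by
  refine LipschitzWith.of_dist_le_mul fun a b => ?_
  rw [tangentProj, tangentProj, dist_eq_norm, ← map_sub, sub_sub_sub_cancel_right, dist_eq_norm,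
    NNReal.coe_one, one_mul]
  exact Submodule.norm_orthogonalProjectionOnto_apply_le _ _

lemma hasFDerivAt_tangentProj (x : E) :
    HasFDerivAt (tangentProj M y) (tangentSpace M y).orthogonalProjectionOnto x :=
  (tangentSpace M y).orthogonalProjectionOnto.hasFDerivAt.comp x ((hasFDerivAt_id x).sub_const y)

lemma RegularManifold.reach_pos (hM : RegularManifold d β τmin L M) : 0 < reach M :=
  lt_of_le_of_lt zero_le hM.reach_gt

/-- The inverse projection is a section of the tangential projection, with values in `M`: it cannot
take its default value, because it is continuously differentiable and the composition of its
derivative with the projection is the identity on the image and `0` off the image. -/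
lemma RegularManifold.inverseProj_spec (hM : RegularManifold d β τmin L M) (hβ : 1 ≤ β)
    (hy : y ∈ M) {z : tangentSpace M y} (hz : z ∈ eball 0 (reach M / 8)) :
    inverseProj M y z ∈ M ∧ tangentProj M y (inverseProj M y z) = z ∧
      edist (inverseProj M y z) y ≤ reach M / 4 := by
  set B : Set (tangentSpace M y) := eball 0 (reach M / 8) with hB
  set Φ := inverseProj M y with hΦ
  set A : tangentSpace M y → Prop := fun z => ∃ a ∈ M ∩ eball y (reach M / 4),
    tangentProj M y a = z with hA
  -- The default value of `Function.invFunOn`, taken where the projection has no preimage.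
  set c : E := Classical.choice ⟨y⟩ with hc
  have hAmem : ∀ z, A z → Φ z ∈ M ∩ eball y (reach M / 4) := fun z h => Function.invFunOn_mem h
  have hAeq : ∀ z, A z → tangentProj M y (Φ z) = z := fun z h => Function.invFunOn_eq h
  have hAneg : ∀ z, ¬ A z → Φ z = c := fun z h => Function.invFunOn_neg h
  have hBo : IsOpen B := isOpen_eball
  have h0B : (0 : tangentSpace M y) ∈ B :=
    mem_eball_self (ENNReal.div_pos hM.reach_pos.ne' (by simp))
  have hC : ContDiffOn ℝ β Φ B := (hM.norm_le y hy).1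
  have hcont : ContinuousOn Φ B := hC.continuousOn
  have hdiff : ∀ z ∈ B, DifferentiableAt ℝ Φ z := fun z hz =>
    (hC.contDiffAt (hBo.mem_nhds hz)).differentiableAt (by norm_cast; omega)
  set p := (tangentSpace M y).orthogonalProjectionOnto with hp
  have hfd : ContinuousOn (fun z => p ∘L fderiv ℝ Φ z) B :=
    continuousOn_const.clm_comp (hC.continuousOn_fderiv_of_isOpen hBo (by exact_mod_cast hβ))
  set U : Set (tangentSpace M y) := {z ∈ B | Φ z ≠ c} with hU
  have hUo : IsOpen U := hcont.isOpen_inter_preimage hBo isOpen_compl_singleton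
  have hUA : ∀ z ∈ U, A z := fun z hz => by
    by_contra h
    exact hz.2 (hAneg z h)
  have hgU : ∀ z ∈ U, p ∘L fderiv ℝ Φ z = ContinuousLinearMap.id ℝ _ := by
    intro z hz
    have h1 : HasFDerivAt (fun z => tangentProj M y (Φ z)) (p ∘L fderiv ℝ Φ z) z :=
      (hasFDerivAt_tangentProj (Φ z)).comp z (hdiff z hz.1).hasFDerivAt
    have h2 : (fun z => tangentProj M y (Φ z)) =ᶠ[𝓝 z] id := by
      filter_upwards [hUo.mem_nhds hz] with w hw
      exact hAeq w (hUA w hw)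
    exact h1.unique ((hasFDerivAt_id z).congr_of_eventuallyEq h2)
  have hgcl : ∀ z ∈ B, z ∈ closure U → p ∘L fderiv ℝ Φ z = ContinuousLinearMap.id ℝ _ := by
    intro z hz hzU
    have h1 := ((hfd z hz).mono (fun w hw => hw.1 : U ⊆ B)).mem_closure_image hzU
    have h2 : (fun z => p ∘L fderiv ℝ Φ z) '' U ⊆ {ContinuousLinearMap.id ℝ _} := by
      rintro _ ⟨w, hw, rfl⟩
      exact hgU w hw
    exact closure_minimal h2 isClosed_singleton h1
  have hg0 : ∀ z ∈ B, z ∉ closure U → p ∘L fderiv ℝ Φ z = 0 := by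
    intro z hz hzU
    have h2 : Φ =ᶠ[𝓝 z] fun _ => c := by
      filter_upwards [hBo.mem_nhds hz, isClosed_closure.isOpen_compl.mem_nhds hzU] with w hw hwU
      by_contra h
      exact hwU (subset_closure ⟨hw, h⟩)
    rw [h2.fderiv_eq]
    simp
  have hconst : ∀ z ∈ B, p ∘L fderiv ℝ Φ z = p ∘L fderiv ℝ Φ 0 := by
    intro z hz
    -- A continuous map from a connected ball to the discrete set `{id, 0}` is constant.
    refine (convex_eball _ _).isPreconnected.constant_of_mapsTo
      (T := ({ContinuousLinearMap.id ℝ (tangentSpace M y), 0} : Set _))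
      (toFinite _).isDiscrete hfd (fun w hw => ?_) hz h0B
    by_cases h : w ∈ closure U
    · exact Or.inl (hgcl w hw h)
    · exact Or.inr (hg0 w hw h)
  have h14 : reach M / 8 ≤ reach M / 4 := by gcongr; norm_num
  have hq0 : A 0 := ⟨y, ⟨hy, mem_eball_self (ENNReal.div_pos hM.reach_pos.ne' (by simp))⟩,
    tangentProj_self⟩
  obtain ⟨q, ⟨hqM, hqy⟩, hq⟩ := hM.smooth.exists_tangentProj_ne_zero hβ (by linarith [hM.dim_ge]) hy
    (eball_mem_nhds y (ENNReal.div_pos hM.reach_pos.ne' (by simp) : 0 < reach M / 8))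
  have hqB : tangentProj M y q ∈ B := by
    have := lipschitzWith_tangentProj (M := M) (y := y) q y
    rw [tangentProj_self, ENNReal.coe_one, one_mul] at this
    exact this.trans_lt hqy
  have hqA : A (tangentProj M y q) := ⟨q, ⟨hqM, eball_subset_eball h14 hqy⟩, rfl⟩
  have hid0 : ContinuousLinearMap.id ℝ (tangentSpace M y) ≠ 0 := fun h => hq (by
    simpa using congrArg (fun f => f (tangentProj M y q)) h)
  have hUne : U.Nonempty := by
    by_contra! h
    have hΦc : ∀ z ∈ B, Φ z = c := fun z hz => by
      by_contra h'
      exact (h ▸ (⟨hz, h'⟩ : z ∈ U) : z ∈ (∅ : Set _))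
    have h1 := hAeq _ hqA
    have h2 := hAeq _ hq0
    rw [hΦc _ hqB] at h1
    rw [hΦc _ h0B] at h2
    exact hq (h1.symm.trans h2)
  obtain ⟨u, hu⟩ := hUne
  have hzcl : z ∈ closure U := by
    by_contra h
    exact hid0 (by rw [← hgU u hu, hconst u hu.1, ← hconst z hz, hg0 z hz h])
  -- The wanted properties hold on `U` and are closed, so they pass to its closure; hence the
  -- non-strict `≤ reach M / 4`.
  have hpair := ((hcont.prodMk continuousOn_id) z hz).mono (fun w hw => hw.1 : U ⊆ B)
  have hK : IsClosed {x : E × tangentSpace M y | x.1 ∈ M ∧ tangentProj M y x.1 = x.2 ∧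
      edist x.1 y ≤ reach M / 4} :=
    (hM.isCompact.isClosed.preimage continuous_fst).inter
      ((isClosed_eq (lipschitzWith_tangentProj.continuous.comp continuous_fst)
        continuous_snd).inter (isClosed_le (continuous_fst.edist continuous_const)
        continuous_const))
  refine closure_minimal ?_ hK (hpair.mem_closure_image hzcl)
  rintro _ ⟨w, hw, rfl⟩
  exact ⟨(hAmem w (hUA w hw)).1, hAeq w (hUA w hw), (hAmem w (hUA w hw)).2.le⟩

lemma RegularManifold.r₀_pos (hM : RegularManifold d β τmin L M) : 0 < r₀ M L := by
  have h1 : 0 < (min 1 (reach M)).toReal :=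
    ENNReal.toReal_pos (lt_min one_pos hM.reach_pos).ne' (ne_top_of_le_ne_top (by simp)
      (min_le_left _ _))
  have := hM.L_pos
  unfold r₀
  positivity

lemma RegularManifold.mul_r₀_le (hM : RegularManifold d β τmin L M) : L * r₀ M L ≤ 1 / 8 := by
  have h := hM.L_pos
  have h1 : r₀ M L ≤ L⁻¹ / 8 := by
    unfold r₀
    gcongr
    exact min_le_right _ _
  calc L * r₀ M L ≤ L * (L⁻¹ / 8) := by gcongr
    _ = 1 / 8 := by field_simp

lemma RegularManifold.differentiableAt_inverseProj (hM : RegularManifold d β τmin L M)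
    (hβ : 1 ≤ β) (hy : y ∈ M) {z : tangentSpace M y} (hz : z ∈ ball 0 (r₀ M L)) :
    DifferentiableAt ℝ (inverseProj M y) z :=
  ((hM.norm_le y hy).1.contDiffAt (isOpen_eball.mem_nhds
    (ball_r₀_subset M L y hz))).differentiableAt (by norm_cast; omega)

lemma RegularManifold.norm_fderiv_inverseProj_le (hM : RegularManifold d β τmin L M)
    (hβ : 1 ≤ β) (hy : y ∈ M) {z : tangentSpace M y} (hz : z ∈ ball 0 (r₀ M L)) :
    ‖fderiv ℝ (inverseProj M y) z‖ ≤ L :=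
  (hM.norm_le y hy).norm_fderiv_le hβ isOpen_eball (ball_r₀_subset M L y hz)

lemma RegularManifold.norm_fderiv_sub_fderiv_zero_le (hM : RegularManifold d β τmin L M)
    (hβ : 2 ≤ β) (hy : y ∈ M) {z : tangentSpace M y} (hz : z ∈ ball 0 (r₀ M L)) :
    ‖fderiv ℝ (inverseProj M y) z - fderiv ℝ (inverseProj M y) 0‖ ≤ L * ‖z‖ := by
  simpa using (hM.norm_le y hy).norm_fderiv_sub_le hβ isOpen_eball (convex_eball _ _)
    (ball_r₀_subset M L y hz) (ball_r₀_subset M L y (mem_ball_self hM.r₀_pos))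

lemma RegularManifold.tangentProj_inverseProj (hM : RegularManifold d β τmin L M) (hβ : 1 ≤ β)
    (hy : y ∈ M) {z : tangentSpace M y} (hz : z ∈ ball 0 (r₀ M L)) :
    tangentProj M y (inverseProj M y z) = z :=
  (hM.inverseProj_spec hβ hy (ball_r₀_subset M L y hz)).2.1

lemma RegularManifold.inverseProj_mem (hM : RegularManifold d β τmin L M) (hβ : 1 ≤ β)
    (hy : y ∈ M) {z : tangentSpace M y} (hz : z ∈ ball 0 (r₀ M L)) : inverseProj M y z ∈ M :=
  (hM.inverseProj_spec hβ hy (ball_r₀_subset M L y hz)).1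

/-- Tangent balls do not meet `M`: the normal component of a secant is at most half its length. -/
lemma RegularManifold.norm_normal_le (hM : RegularManifold d β τmin L M) (hβ : 2 ≤ β)
    (hy : y ∈ M) {q : E} (hq : q ∈ M) (hlt : edist q y < reach M) :
    2 * ‖(tangentSpace M y)ᗮ.orthogonalProjectionOnto (q - y)‖ ≤ ‖q - y‖ := by
  set m := (tangentSpace M y)ᗮ.orthogonalProjectionOnto (q - y) with hm
  rcases eq_or_ne m 0 with h0 | h0
  · rw [h0]; simp
  have hm0 : 0 < ‖m‖ := norm_pos_iff.2 h0
  have hqy : 0 < ‖q - y‖ := hm0.trans_le (Submodule.norm_orthogonalProjectionOnto_apply_le _ _)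
  have hinner : inner ℝ (q - y) (m : E) = ‖m‖ ^ 2 := by
    rw [← Submodule.inner_orthogonalProjectionOnto_eq_of_mem_right, ← hm,
      real_inner_self_eq_norm_sq]
  have hlt' : ENNReal.ofReal ‖q - y‖ < reach M := by rwa [← dist_eq_norm, ← edist_dist]
  have hn1 : ‖(‖m‖⁻¹ • (m : E))‖ = 1 := by
    rw [norm_smul, norm_inv, norm_norm, Submodule.coe_norm, inv_mul_cancel₀]
    exact hm0.ne'
  -- The tangent ball of radius `‖q - y‖` in the direction of the normal component of `q - y`.
  have h := hM.smooth.le_dist_add_smul hβ hM.isCompact hy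
    (Submodule.smul_mem _ ‖m‖⁻¹ m.2) hn1 hqy hlt' hq
  have h2 : ‖q - y‖ ^ 2 ≤ dist (y + ‖q - y‖ • ‖m‖⁻¹ • (m : E)) q ^ 2 := by gcongr
  rw [dist_comm, dist_eq_norm, ← sub_sub, norm_sub_sq_real (q - y), norm_smul, hn1, real_inner_smul_right,
    real_inner_smul_right, hinner, norm_norm, mul_one, pow_two ‖m‖, inv_mul_cancel_left₀ hm0.ne']
    at h2
  nlinarith

/-- The chosen point over `0` differs from `y` by a normal vector, which is at most half its own
length. -/
lemma RegularManifold.inverseProj_zero (hM : RegularManifold d β τmin L M) (hβ : 2 ≤ β)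
    (hy : y ∈ M) : inverseProj M y 0 = y := by
  obtain ⟨h1, h2, h3⟩ := hM.inverseProj_spec (by omega) hy
    (ball_r₀_subset M L y (mem_ball_self hM.r₀_pos))
  set q := inverseProj M y 0
  have h4 := hM.norm_normal_le hβ hy h1
    (edist_lt_reach_of_le hM.reach_pos (h3.trans le_add_self))
  have h5 : q - y ∈ (tangentSpace M y)ᗮ := Submodule.orthogonalProjectionOnto_eq_zero_iff.1 h2
  rw [Submodule.norm_orthogonalProjectionOnto_apply _ h5] at h4
  have h6 : ‖q - y‖ = 0 := le_antisymm (by linarith) (norm_nonneg _)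
  exact sub_eq_zero.1 (norm_eq_zero.1 h6)

end InverseProj

/-! ### Local graphs, volume of small balls, variation of tangent spaces -/

section Cover

variable {E : Type*} [NormedAddCommGroup E] [InnerProductSpace ℝ E] [FiniteDimensional ℝ E]
  {M : Set E} {d β : ℕ} {τmin L : ℝ} {y : E}

lemma RegularManifold.orthogonalProjectionOnto_fderiv (hM : RegularManifold d β τmin L M)
    (hβ : 1 ≤ β) (hy : y ∈ M) {z : tangentSpace M y} (hz : z ∈ ball 0 (r₀ M L))
    (w : tangentSpace M y) :
    (tangentSpace M y).orthogonalProjectionOnto (fderiv ℝ (inverseProj M y) z w) = w := by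
  have h1 : HasFDerivAt (fun z => tangentProj M y (inverseProj M y z))
      ((tangentSpace M y).orthogonalProjectionOnto ∘L fderiv ℝ (inverseProj M y) z) z :=
    HasFDerivAt.comp (g := tangentProj M y) z (hasFDerivAt_tangentProj _)
      (hM.differentiableAt_inverseProj hβ hy hz).hasFDerivAt
  have h2 : (fun z => tangentProj M y (inverseProj M y z)) =ᶠ[𝓝 z] id := by
    filter_upwards [isOpen_ball.mem_nhds hz] with u hu
    exact hM.tangentProj_inverseProj hβ hy hu
  have h3 := h1.unique ((hasFDerivAt_id z).congr_of_eventuallyEq h2)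
  exact congrArg (fun f => f w) h3

lemma RegularManifold.fderiv_mem_tangentSpace (hM : RegularManifold d β τmin L M)
    (hβ : 1 ≤ β) (hy : y ∈ M) {z : tangentSpace M y} (hz : z ∈ ball 0 (r₀ M L))
    (w : tangentSpace M y) :
    fderiv ℝ (inverseProj M y) z w ∈ tangentSpace M (inverseProj M y z) := by
  refine ManifoldNoise.fderiv_mem_tangentSpace (hM.differentiableAt_inverseProj hβ hy hz) ?_ w
  filter_upwards [isOpen_ball.mem_nhds hz] with u hu
  exact hM.inverseProj_mem hβ hy hu

lemma RegularManifold.fderiv_inverseProj_zero (hM : RegularManifold d β τmin L M)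
    (hβ : 2 ≤ β) (hy : y ∈ M) (w : tangentSpace M y) :
    fderiv ℝ (inverseProj M y) 0 w = w := by
  have h0 := mem_ball_self (x := (0 : tangentSpace M y)) hM.r₀_pos
  have h1 := hM.fderiv_mem_tangentSpace (by omega) hy h0 w
  rw [hM.inverseProj_zero hβ hy] at h1
  have h2 := hM.orthogonalProjectionOnto_fderiv (by omega) hy h0 w
  have h3 := Submodule.orthogonalProjectionOnto_mem_subspace_eq_self
    (⟨_, h1⟩ : tangentSpace M y)
  rw [h2] at h3
  exact (congrArg Subtype.val h3).symm

lemma RegularManifold.norm_inverseProj_sub_le (hM : RegularManifold d β τmin L M)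
    (hβ : 2 ≤ β) (hy : y ∈ M) {z : tangentSpace M y} (hz : z ∈ ball 0 (r₀ M L)) :
    ‖inverseProj M y z - y‖ ≤ L * ‖z‖ := by
  have h := (convex_ball (0 : tangentSpace M y) (r₀ M L)).norm_image_sub_le_of_norm_fderiv_le
    (𝕜 := ℝ) (fun u hu => hM.differentiableAt_inverseProj (by omega) hy hu)
    (fun u hu => hM.norm_fderiv_inverseProj_le (by omega) hy hu) (mem_ball_self hM.r₀_pos) hz
  rwa [hM.inverseProj_zero hβ hy, sub_zero] at h

/-- The 1-Lipschitz projection maps the piece of `M` onto a superset of the flat ball, and does not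
increase measure. The dimension of the tangent space is not yet needed. -/
lemma RegularManifold.measure_ball_le [MeasurableSpace E] [BorelSpace E]
    (hM : RegularManifold d β τmin L M) (hβ : 2 ≤ β)
    (hy : y ∈ M) {ρ ρ' : ℝ} (hρ : ρ ≤ r₀ M L) (hρ' : L * ρ ≤ ρ') :
    Measure.euclideanHausdorffMeasure d (ball (0 : tangentSpace M y) ρ) ≤
      Measure.euclideanHausdorffMeasure d (ball y ρ' ∩ M) := by
  have hsub : ball (0 : tangentSpace M y) ρ ⊆ tangentProj M y '' (ball y ρ' ∩ M) := by
    intro z hz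
    have hz' := ball_subset_ball hρ hz
    refine ⟨inverseProj M y z, ⟨?_, hM.inverseProj_mem (by omega) hy hz'⟩,
      hM.tangentProj_inverseProj (by omega) hy hz'⟩
    rw [mem_ball, dist_eq_norm]
    refine (hM.norm_inverseProj_sub_le hβ hy hz').trans_lt (lt_of_lt_of_le ?_ hρ')
    exact mul_lt_mul_of_pos_left (mem_ball_zero_iff.1 hz) hM.L_pos
  refine (measure_mono hsub).trans ?_
  simpa using (lipschitzWith_tangentProj.lipschitzOnWith
    (s := ball y ρ' ∩ M)).euclideanHausdorffMeasure_image_le d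

/-- In a tangent space of dimension above `d`, a ball would have infinite `d`-dimensional measure,
and by `measure_ball_le` so would `M`. -/
lemma RegularManifold.finrank_tangentSpace (hM : RegularManifold d β τmin L M) (hβ : 2 ≤ β)
    (hy : y ∈ M) : Module.finrank ℝ (tangentSpace M y) = d := by
  borelize E
  refine le_antisymm ?_ (hM.smooth.le_finrank_tangentSpace (by omega) hy)
  by_contra! h
  rcases Measure.euclideanHausdorffMeasure_zero_or_top h
    (ball (0 : tangentSpace M y) (r₀ M L)) with h0 | h0
  · rw [InnerProductSpace.euclideanHausdorffMeasure_eq_volume] at h0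
    exact (measure_ball_pos _ _ hM.r₀_pos).ne' h0
  · have h1 := hM.measure_ball_le hβ hy le_rfl le_rfl
    rw [h0, top_le_iff] at h1
    refine hM.smooth.measure_ne_top (by omega) hM.isCompact (top_le_iff.1 ?_)
    rw [← h1]
    exact measure_mono inter_subset_right

/-- The derivative of `Φ_y` at `0` is the isometric inclusion of a nonzero space. -/
lemma RegularManifold.one_le_L (hM : RegularManifold d β τmin L M) (hβ : 2 ≤ β) (hy : y ∈ M) :
    1 ≤ L := by
  have hpos : 0 < Module.finrank ℝ (tangentSpace M y) := by
    rw [hM.finrank_tangentSpace hβ hy]; linarith [hM.dim_ge]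
  have : Nontrivial (tangentSpace M y) := Module.nontrivial_of_finrank_pos hpos
  obtain ⟨w, hw⟩ := exists_ne (0 : tangentSpace M y)
  have h1 := (fderiv ℝ (inverseProj M y) 0).le_of_opNorm_le
    (hM.norm_fderiv_inverseProj_le (by omega) hy (mem_ball_self hM.r₀_pos)) w
  rw [hM.fderiv_inverseProj_zero hβ hy, ← Submodule.coe_norm] at h1
  exact le_of_mul_le_mul_right (by linarith) (norm_pos_iff.2 hw)

lemma RegularManifold.pow_le_measure [MeasurableSpace E] [BorelSpace E]
    (hM : RegularManifold d β τmin L M) (hβ : 2 ≤ β)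
    (hy : y ∈ M) {ρ : ℝ} (hρ0 : 0 < ρ) (hρ : ρ ≤ r₀ M L) :
    ENNReal.ofReal ((ρ / (L * d)) ^ d) ≤
      Measure.euclideanHausdorffMeasure d (ball y ρ ∩ M) := by
  have hL := hM.one_le_L hβ hy
  have hd := hM.finrank_tangentSpace hβ hy
  have h1 := pow_div_finrank_le_volume_ball (V := tangentSpace M y)
    (by rw [hd]; linarith [hM.dim_ge]) 0 (r := ρ / L) (by positivity)
  have h2 := hM.measure_ball_le hβ hy (ρ := ρ / L) (ρ' := ρ)
    ((div_le_self hρ0.le hL).trans hρ) (by rw [mul_div_cancel₀]; positivity)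
  rw [← InnerProductSpace.euclideanHausdorffMeasure_eq_volume, hd, div_div] at h1
  exact h1.trans h2

/-- The tangent space at `inverseProj M y z` is the range of the derivative of `inverseProj M y` at
`z`, and hence close to the tangent space at `y`. -/
lemma RegularManifold.norm_sub_projection_le_of_inverseProj (hM : RegularManifold d β τmin L M)
    (hβ : 2 ≤ β) (hy : y ∈ M) {z : tangentSpace M y} (hz : z ∈ ball 0 (r₀ M L)) {v : E}
    (hv : v ∈ tangentSpace M (inverseProj M y z)) :
    ‖v - (tangentSpace M y).orthogonalProjectionOnto v‖ ≤ L * ‖z‖ * ‖v‖ := by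
  set f : tangentSpace M y →ₗ[ℝ] tangentSpace M (inverseProj M y z) :=
    (fderiv ℝ (inverseProj M y) z : tangentSpace M y →ₗ[ℝ] E).codRestrict _
      (hM.fderiv_mem_tangentSpace (by omega) hy hz) with hf
  have hinj : Function.Injective f := fun a b hab => by
    rw [← hM.orthogonalProjectionOnto_fderiv (by omega) hy hz a,
      ← hM.orthogonalProjectionOnto_fderiv (by omega) hy hz b]
    exact congrArg _ (congrArg Subtype.val hab)
  have hsurj : Function.Surjective f :=
    (LinearMap.injective_iff_surjective_of_finrank_eq_finrank (by
      rw [hM.finrank_tangentSpace hβ hy,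
        hM.finrank_tangentSpace hβ (hM.inverseProj_mem (by omega) hy hz)])).1 hinj
  obtain ⟨w, hw⟩ := hsurj ⟨v, hv⟩
  have hw' : fderiv ℝ (inverseProj M y) z w = v := congrArg Subtype.val hw
  have hwv : (tangentSpace M y).orthogonalProjectionOnto v = w := by
    rw [← hw', hM.orthogonalProjectionOnto_fderiv (by omega) hy hz]
  have hnorm : ‖w‖ ≤ ‖v‖ := by
    rw [← hwv]; exact Submodule.norm_orthogonalProjectionOnto_apply_le _ _
  have hL := hM.L_pos
  calc ‖v - (tangentSpace M y).orthogonalProjectionOnto v‖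
      = ‖(fderiv ℝ (inverseProj M y) z - fderiv ℝ (inverseProj M y) 0) w‖ := by
        rw [sub_apply, hw', hM.fderiv_inverseProj_zero hβ hy, hwv]
    _ ≤ L * ‖z‖ * ‖w‖ := ContinuousLinearMap.le_of_opNorm_le _
        (hM.norm_fderiv_sub_fderiv_zero_le hβ hy hz) w
    _ ≤ _ := by gcongr

/-- Near `y`, the manifold coincides with the graph parametrized by `inverseProj M y`. -/
lemma RegularManifold.inverseProj_tangentProj (hM : RegularManifold d β τmin L M)
    (hβ : 2 ≤ β) (hy : y ∈ M) {q : E} (hq : q ∈ M) (hqy : ‖q - y‖ < r₀ M L) :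
    inverseProj M y (tangentProj M y q) = q := by
  set z := tangentProj M y q with hz'
  have hzn : ‖z‖ ≤ ‖q - y‖ := Submodule.norm_orthogonalProjectionOnto_apply_le _ _
  have hz : z ∈ ball 0 (r₀ M L) := mem_ball_zero_iff.2 (hzn.trans_lt hqy)
  obtain ⟨hpM, hpz, hpy⟩ := hM.inverseProj_spec (by omega) hy (ball_r₀_subset M L y hz)
  set p := inverseProj M y z with hp
  have hqp : edist q p ≤ reach M / 8 + reach M / 4 := by
    refine (edist_triangle q y p).trans (add_le_add ?_ (by rwa [edist_comm]))
    rw [edist_dist, dist_eq_norm]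
    exact (ENNReal.ofReal_le_ofReal hqy.le).trans (ofReal_r₀_le M L)
  have h1 := hM.norm_normal_le hβ hpM hq (edist_lt_reach_of_le hM.reach_pos hqp)
  -- The secant `q - p` is orthogonal to `T_yM`, and `T_pM` is `1/8`-close to `T_yM`, so its part
  -- tangent at `p` is at most an eighth of it. The reach bounds the normal part by a half, and
  -- Pythagoras forces `q = p`.
  set k := (tangentSpace M p).orthogonalProjectionOnto (q - p) with hk
  have horth : (tangentSpace M y).orthogonalProjectionOnto (q - p) = 0 := by
    have : tangentProj M y q - tangentProj M y p = 0 := by rw [hpz, sub_self]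
    rwa [tangentProj, tangentProj, ← map_sub, sub_sub_sub_cancel_right] at this
  have hkk : ‖k‖ ^ 2 = inner ℝ (q - p) (k : E) := by
    rw [← real_inner_self_eq_norm_sq]
    exact Submodule.inner_orthogonalProjectionOnto_eq_of_mem_right k (q - p)
  have h2 : inner ℝ (q - p) (k : E) =
      inner ℝ (q - p) ((k : E) - (tangentSpace M y).orthogonalProjectionOnto (k : E)) := by
    rw [inner_sub_right, ← Submodule.inner_orthogonalProjectionOnto_eq_of_mem_right
      ((tangentSpace M y).orthogonalProjectionOnto (k : E)), horth,
      inner_zero_left, sub_zero]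
  have h3 := hM.norm_sub_projection_le_of_inverseProj hβ hy hz k.2
  have hLz : L * ‖z‖ ≤ 1 / 8 := by
    have := hM.L_pos
    refine le_trans ?_ hM.mul_r₀_le
    gcongr
    exact hzn.trans hqy.le
  have h4 : ‖k‖ ^ 2 ≤ ‖q - p‖ * (1 / 8 * ‖k‖) := by
    rw [hkk, h2]
    refine (real_inner_le_norm _ _).trans ?_
    gcongr
    exact h3.trans (by gcongr; exact le_rfl)
  have h5 : ‖k‖ ≤ ‖q - p‖ / 8 := by
    rcases (norm_nonneg k).eq_or_lt with h0 | h0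
    · rw [← h0]; positivity
    · nlinarith
  have h6 := Submodule.norm_sq_eq_add_norm_sq_projection (q - p) (tangentSpace M p)
  rw [← hk] at h6
  have h7 : ‖q - p‖ ^ 2 ≤ 0 := by
    nlinarith [norm_nonneg k, norm_nonneg (q - p),
      norm_nonneg ((tangentSpace M p)ᗮ.orthogonalProjectionOnto (q - p))]
  have h8 : ‖q - p‖ = 0 := pow_eq_zero_iff two_ne_zero |>.1 (le_antisymm h7 (sq_nonneg _))
  exact (sub_eq_zero.1 (norm_eq_zero.1 h8)).symm

/-- Tangent spaces vary in a Lipschitz way. -/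
lemma RegularManifold.norm_sub_projection_le (hM : RegularManifold d β τmin L M)
    (hβ : 2 ≤ β) (hy : y ∈ M) {q : E} (hq : q ∈ M) (hqy : ‖q - y‖ < r₀ M L) {v : E}
    (hv : v ∈ tangentSpace M q) :
    ‖v - (tangentSpace M y).orthogonalProjectionOnto v‖ ≤ L * ‖q - y‖ * ‖v‖ := by
  have hzn : ‖tangentProj M y q‖ ≤ ‖q - y‖ := Submodule.norm_orthogonalProjectionOnto_apply_le _ _
  have h := hM.norm_sub_projection_le_of_inverseProj hβ hy (z := tangentProj M y q)
    (mem_ball_zero_iff.2 (hzn.trans_lt hqy)) (v := v)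
    (by rwa [hM.inverseProj_tangentProj hβ hy hq hqy])
  have := hM.L_pos
  exact h.trans (by gcongr)

end Cover

/-! ### Nets of unit tangent vectors -/

section TangentNet

variable {E : Type*} [NormedAddCommGroup E] [InnerProductSpace ℝ E] [FiniteDimensional ℝ E]
  [MeasurableSpace E] [BorelSpace E] {M : Set E} {d β : ℕ} {τmin L : ℝ}

/-- Unit tangent vectors of `M` have nets whose size is controlled by the volume of `M`. -/
lemma RegularManifold.exists_tangent_net (hM : RegularManifold d β τmin L M) (hβ : 2 ≤ β) (k : ℕ) :
    ∃ T : Finset E, (T.card : ℝ) ≤ vol d M * (d * ((r₀ M L)⁻¹ ^ 2) ^ (k + 2)) ^ d ∧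
      (∀ w ∈ T, ‖w‖ ≤ 1) ∧
      ∀ q ∈ M, ∀ v ∈ tangentSpace M q, ‖v‖ = 1 → ∃ w ∈ T, ‖v - w‖ ≤ (1 / 4) ^ k / 4 := by
  classical
  set r := r₀ M L with hr
  have hr0 : 0 < r := hM.r₀_pos
  have hr8 : r ≤ 1 / 8 := r₀_le M L
  have hLr : L * r ≤ 1 / 8 := hM.mul_r₀_le
  have hL := hM.L_pos
  have hd : (0 : ℝ) < d := by exact_mod_cast (by linarith [hM.dim_ge] : 0 < d)
  have h4k : (0 : ℝ) < (1 / 4) ^ k := by positivity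
  have h4k1 : (1 / 4 : ℝ) ^ k ≤ 1 := pow_le_one₀ (by norm_num) (by norm_num)
  -- As `L * r ≤ 1/8`, moving the base point by `ε` costs at most `4 ^ (-k) / 16`; with `η = 4 ^
  -- (-k) / 8` in the fibre the total is below `4 ^ (-k) / 4`.
  set ε := r * (1 / 4) ^ k / 2 with hε
  have hε0 : 0 < ε := by positivity
  have hεr : ε < r := by rw [hε]; nlinarith
  set c := (ε / 2 / (L * d)) ^ d with hc
  have hc0 : 0 < c := by positivity
  obtain ⟨F, hFM, hFnet, hFcard⟩ := exists_finset_net_of_le_measure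
    (Measure.euclideanHausdorffMeasure d : Measure E) (A := M) (B := M) hε0 hc0
    (hM.smooth.measure_ne_top (by omega) hM.isCompact)
    (fun x hx => hM.pow_le_measure hβ hx (half_pos hε0) (by linarith))
  set η : ℝ := (1 / 4) ^ k / 8 with hη
  have hη0 : 0 < η := by positivity
  choose G hG1 hGnet hGcard using fun y : E =>
    exists_finset_net_closedBall (V := tangentSpace M y) hη0
  refine ⟨F.biUnion fun y => (G y).image Subtype.val, ?_, ?_, ?_⟩
  · have h1 : ((F.biUnion fun y => (G y).image Subtype.val).card : ℝ) ≤
        F.card * (1 + 2 / η) ^ d := by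
      refine (Nat.cast_le.2 Finset.card_biUnion_le).trans ?_
      rw [Nat.cast_sum, ← nsmul_eq_mul]
      refine Finset.sum_le_card_nsmul _ _ _ fun y hy => ?_
      rw [← hM.finrank_tangentSpace hβ (hFM hy)]
      exact (Nat.cast_le.2 Finset.card_image_le).trans (hGcard y)
    have h2 : (F.card : ℝ) ≤ vol d M * (c⁻¹) := by
      rw [← div_eq_mul_inv, le_div_iff₀ hc0]
      exact hFcard
    have hvol : 0 ≤ vol d M := measureReal_nonneg
    have h3 : c⁻¹ * (1 + 2 / η) ^ d = (2 * (L * d) / ε * (1 + 2 / η)) ^ d := by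
      rw [hc, ← inv_pow, ← mul_pow]
      congr 2
      field_simp
    have h4 : 2 * (L * d) / ε * (1 + 2 / η) ≤ d * ((r⁻¹) ^ 2) ^ (k + 2) := by
      have hL' : L ≤ r⁻¹ / 8 := by
        rw [le_div_iff₀ (by norm_num), ← one_div, le_div_iff₀ hr0]; linarith
      have hR : (64 : ℝ) ≤ r⁻¹ ^ 2 := by
        have : (8 : ℝ) ≤ r⁻¹ := by rw [← one_div, le_div_iff₀ hr0]; linarith
        nlinarith
      have h5 : 2 * (L * d) / ε = 4 * L * d * r⁻¹ * 4 ^ k := by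
        rw [hε, one_div, inv_pow]; field_simp; norm_num
      have h6 : 1 + 2 / η ≤ 17 * 4 ^ k := by
        have h7 : 2 / η = 16 * 4 ^ k := by rw [hη, one_div, inv_pow]; field_simp; norm_num
        have h8 : (1 : ℝ) ≤ 4 ^ k := one_le_pow₀ (by norm_num)
        rw [h7]; linarith
      rw [h5]
      calc 4 * L * d * r⁻¹ * 4 ^ k * (1 + 2 / η)
          ≤ 4 * (r⁻¹ / 8) * d * r⁻¹ * 4 ^ k * (17 * 4 ^ k) := by gcongr
        _ = d * (r⁻¹ ^ 2 * (17 / 2 * 16 ^ k)) := by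
          rw [show (16 : ℝ) = 4 * 4 by norm_num, mul_pow]; ring
        _ ≤ d * (r⁻¹ ^ 2 * (r⁻¹ ^ 2 * (r⁻¹ ^ 2) ^ k)) := by
          gcongr <;> linarith
        _ = _ := by rw [pow_add _ k 2]; ring
    calc ((F.biUnion fun y => (G y).image Subtype.val).card : ℝ)
        ≤ F.card * (1 + 2 / η) ^ d := h1
      _ ≤ vol d M * c⁻¹ * (1 + 2 / η) ^ d := by gcongr
      _ = vol d M * (2 * (L * d) / ε * (1 + 2 / η)) ^ d := by rw [mul_assoc, h3]
      _ ≤ _ := by gcongr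
  · intro w hw
    obtain ⟨y, -, hw⟩ := Finset.mem_biUnion.1 hw
    obtain ⟨u, hu, rfl⟩ := Finset.mem_image.1 hw
    exact hG1 y u hu
  · intro q hq v hv hv1
    obtain ⟨y, hyF, hqy⟩ := hFnet q hq
    rw [dist_eq_norm] at hqy
    set u := (tangentSpace M y).orthogonalProjectionOnto v with hu
    have hu1 : ‖u‖ ≤ 1 := hv1 ▸ Submodule.norm_orthogonalProjectionOnto_apply_le _ _
    obtain ⟨w, hw, huw⟩ := hGnet y u hu1
    refine ⟨w, Finset.mem_biUnion.2 ⟨y, hyF, Finset.mem_image_of_mem _ hw⟩, ?_⟩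
    have h1 := hM.norm_sub_projection_le hβ (hFM hyF) hq (hqy.trans_lt hεr) hv
    rw [hv1, mul_one, ← hu] at h1
    have h2 : L * ‖q - y‖ ≤ (1 / 4) ^ k / 16 := by
      calc L * ‖q - y‖ ≤ L * ε := by gcongr
        _ = (L * r) * ((1 / 4) ^ k / 2) := by rw [hε]; ring
        _ ≤ 1 / 8 * ((1 / 4) ^ k / 2) := by gcongr
        _ = _ := by ring
    calc ‖v - w‖ = ‖(v - u) + ((u - w : tangentSpace M y) : E)‖ := by
          congr 1; push_cast; abel
      _ ≤ ‖v - u‖ + ‖u - w‖ := norm_add_le _ _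
      _ ≤ (1 / 4) ^ k / 16 + (1 / 4) ^ k / 8 := add_le_add (h1.trans h2) huw
      _ ≤ _ := by linarith

end TangentNet

lemma norm_orthogonalProjectionOnto_le_of_forall_inner_le {E : Type*} [NormedAddCommGroup E]
    [InnerProductSpace ℝ E] (K : Submodule ℝ E) [K.HasOrthogonalProjection] {x : E} {b : ℝ}
    (hb : 0 ≤ b) (h : ∀ v ∈ K, ‖v‖ = 1 → inner ℝ v x ≤ b) : ‖K.orthogonalProjectionOnto x‖ ≤ b := by
  set p := K.orthogonalProjectionOnto x with hp
  rcases eq_or_ne p 0 with h0 | h0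
  · simpa [h0] using hb
  have hp0 : 0 < ‖p‖ := norm_pos_iff.2 h0
  have h1 := h _ (K.smul_mem ‖p‖⁻¹ p.2) (by
    rw [norm_smul, norm_inv, norm_norm, Submodule.coe_norm, inv_mul_cancel₀]
    exact hp0.ne')
  rwa [real_inner_smul_left, ← Submodule.inner_orthogonalProjectionOnto_eq_of_mem_left, ← hp,
    real_inner_self_eq_norm_sq, pow_two, inv_mul_cancel_left₀ hp0.ne'] at h1

end ManifoldNoise

end

/-! ### Main theorem: matching net sizes with `W` -/

theorem theorem4p2 {D d β : ℕ} (hβ : 2 ≤ β) {τmin L : ℝ} {M : Set (EuclideanSpace ℝ (Fin D))}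
    (hM : ManifoldNoise.RegularManifold d β τmin L M)
    {Ω : Type*} [MeasurableSpace Ω] {P : Measure Ω} [IsProbabilityMeasure P]
    {Z : Ω → EuclideanSpace ℝ (Fin D)}
    (hZ : HasLaw Z (stdGaussian (EuclideanSpace ℝ (Fin D))) P)
    {δ : ℝ} (hδ : 0 < δ) :
    1 - δ ≤ P.real {ω | ∀ y ∈ M,
      ‖(ManifoldNoise.tangentSpace M y).orthogonalProjectionOnto (Z ω)‖ ≤
        8 * Real.sqrt (d * (4 * Real.log (2 * d) + 2 * Real.log (ManifoldNoise.r₀ M L)⁻¹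
          + 2 * Real.posLog (ManifoldNoise.vol d M) + 2 * Real.log δ⁻¹))} := by
  rcases le_or_gt 1 δ with h1 | h1
  · exact (sub_nonpos.2 h1).trans measureReal_nonneg
  set r := ManifoldNoise.r₀ M L with hr
  set v := ManifoldNoise.vol d M with hv
  set W := d * (4 * Real.log (2 * d) + 2 * Real.log r⁻¹ + 2 * Real.posLog v + 2 * Real.log δ⁻¹)
    with hW
  have hr0 : 0 < r := hM.r₀_pos
  have hr8 : r ≤ 1 / 8 := ManifoldNoise.r₀_le M L
  have hd : (3 : ℝ) ≤ d := by exact_mod_cast hM.dim_ge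
  have hv0 : 0 ≤ v := measureReal_nonneg
  have hlr : 0 ≤ Real.log r⁻¹ := Real.log_nonneg (by rw [one_le_inv₀ hr0]; linarith)
  have hlδ : 0 ≤ Real.log δ⁻¹ := Real.log_nonneg (by rw [one_le_inv₀ hδ]; exact h1.le)
  have hlv : 0 ≤ Real.posLog v := Real.posLog_nonneg
  have hl2d : Real.log 2 ≤ Real.log (2 * d) := Real.log_le_log (by norm_num) (by linarith)
  have hldd : Real.log d ≤ Real.log (2 * d) := Real.log_le_log (by linarith) (by linarith)
  have hl2 : 0 < Real.log 2 := Real.log_pos (by norm_num)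
  have hWle : 4 * Real.log (2 * d) + 2 * Real.log r⁻¹ + 2 * Real.posLog v + 2 * Real.log δ⁻¹ ≤ W :=
    le_mul_of_one_le_left (by linarith) (by linarith)
  have hexp : ∀ k : ℕ, v * (d * (r⁻¹ ^ 2) ^ (k + 2)) ^ d ≤ Real.exp ((k + 2) * W) := by
    intro k
    have h2 : v ≤ Real.exp (Real.posLog v) := by
      rcases hv0.eq_or_lt with h | h
      · rw [← h]; exact (Real.exp_pos _).le
      · rw [← Real.log_le_iff_le_exp h]; exact le_max_right _ _
    have h3 : (d * (r⁻¹ ^ 2) ^ (k + 2)) ^ d =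
        Real.exp (d * (Real.log d + (k + 2) * (2 * Real.log r⁻¹))) := by
      rw [Real.exp_nat_mul, Real.exp_add, Real.exp_log (by linarith)]
      congr 2
      rw [show ((k : ℝ) + 2) = ((k + 2 : ℕ) : ℝ) by push_cast; ring, Real.exp_nat_mul]
      congr 1
      rw [show (2 : ℝ) = ((2 : ℕ) : ℝ) by norm_num, Real.exp_nat_mul,
        Real.exp_log (by positivity)]
    rw [h3]
    refine (mul_le_mul_of_nonneg_right h2 (Real.exp_pos _).le).trans ?_
    rw [← Real.exp_add, Real.exp_le_exp, hW]
    have h4 : Real.posLog v ≤ d * Real.posLog v := le_mul_of_one_le_left hlv (by linarith)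
    have h5 : Real.posLog v + d * (Real.log d + (k + 2) * (2 * Real.log r⁻¹)) ≤
        d * (Real.posLog v + (Real.log d + (k + 2) * (2 * Real.log r⁻¹))) := by linarith
    refine h5.trans ?_
    rw [mul_left_comm ((k : ℝ) + 2) (d : ℝ)]
    refine mul_le_mul_of_nonneg_left ?_ (by linarith)
    -- The coefficient 2 of `log r⁻¹` is exactly what the nets require; the other terms have slack.
    nlinarith [mul_nonneg (Nat.cast_nonneg (α := ℝ) k) hlv,
      mul_nonneg (Nat.cast_nonneg (α := ℝ) k) hlδ,
      mul_nonneg (Nat.cast_nonneg (α := ℝ) k) (hl2.le.trans hl2d)]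
  choose T hTcard hT1 hTnet using hM.exists_tangent_net hβ
  have key := ManifoldNoise.one_sub_le_measureReal_forall_inner_le hZ
    (S := {v | ∃ y ∈ M, v ∈ ManifoldNoise.tangentSpace M y ∧ ‖v‖ = 1}) T (W := W) (δ := δ)
    (by
      rw [one_div, ← Real.exp_log (by norm_num : (0 : ℝ) < 2⁻¹), Real.exp_le_exp, Real.log_inv]
      linarith)
    (by
      rw [← Real.le_log_iff_exp_le hδ, ← neg_neg (Real.log δ), ← Real.log_inv]
      linarith)
    (fun k => (hTcard k).trans (hexp k)) (hT1 0)
    (by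
      rintro v ⟨y, hy, hvy, hv1⟩ k
      exact hTnet k y hy v hvy hv1)
  refine key.trans (measureReal_mono fun ω hω y hy => ?_)
  exact ManifoldNoise.norm_orthogonalProjectionOnto_le_of_forall_inner_le _ (by positivity)
    fun v hv hv1 => hω v ⟨y, hy, hv, hv1⟩
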